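/- For a polynomial $P(q)\in\mathbb{Q}[q]$ and rational functions $f,g\in\mathbb{Q}(q)$ in the indeterminate $q$, write $f\equiv g \pmod{P(q)}$ if the numerator of $f-g$, written in lowest terms, is divisible by $P(q)$ in $\mathbb{Q}[q]$. Let $[m]=1+q+\cdots+q^{m-1}$ denote the $q$-integer, let $(a;q)_k=(1-a)(1-aq)\cdots(1-aq^{k-1})$ denote the $q$-shifted factorial (so $(q;q^d)_k=\prod_{i=0}^{k-1}(1-q^{di+1})$ and $(q^d;q^d)_k=\prod_{i=1}^{k}(1-q^{di})$), and let $\Phi_n(q)$ denote the $n$-th cyclotomic polynomial. Let $d\geq 3$ and $n$ be positive integers with $n\equiv -1\pmod{d}$. Then $$\sum_{k=0}^{M}[2dk+1]\,\frac{(q;q^d)_k^{2d}}{(q^d;q^d)_k^{2d}}\,q^{d(d-2)k}\equiv 0 \pmod{[n]\,\Phi_n(q)^3}$$ both for $M=\dfrac{(d-1)n-1}{d}$ (which is an integer) and for $M=n-1$. -/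

import Mathlib

namespace QCong

/-- The `q`-integer `[n]_q = 1 + q + ⋯ + q ^ (n - 1)`. -/
def qInt {R : Type*} [CommRing R] (q : R) (n : ℕ) : R :=
  ∑ i ∈ Finset.range n, q ^ i

/-- The `q`-shifted factorial `(a; q)_n = (1 - a) (1 - a q) ⋯ (1 - a q ^ (n - 1))`. -/
def qPoch {R : Type*} [CommRing R] (a q : R) (n : ℕ) : R :=
  ∏ i ∈ Finset.range n, (1 - a * q ^ i)

/-- Congruence of rational functions in the indeterminate `q` modulo a polynomial `P`:
the numerator of the difference, written in lowest terms, is divisible by `P`. -/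
def RatModEq (P : Polynomial ℚ) (f g : RatFunc ℚ) : Prop :=
  P ∣ (f - g).num

/-- The `k`-th summand
`[2dk + 1] * ((q; q ^ d)_k / (q ^ d; q ^ d)_k) ^ (2d) * q ^ (d (d - 2) k)`,
a rational function in the indeterminate `q`; it is used only for `3 ≤ d`, so that
`d - 2` is not truncated. -/
noncomputable def summand (d k : ℕ) : RatFunc ℚ :=
  let q : RatFunc ℚ := RatFunc.X
  qInt q (2 * d * k + 1) *
    (qPoch q (q ^ d) k ^ (2 * d) / qPoch (q ^ d) (q ^ d) k ^ (2 * d)) *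
      q ^ (d * (d - 2) * k)

/-- The modulus `[n] * Φ_n(q) ^ 3`. -/
noncomputable def modulus (n : ℕ) : Polynomial ℚ :=
  qInt (Polynomial.X : Polynomial ℚ) n * Polynomial.cyclotomic n ℚ ^ 3

end QCong

/-! Write d = r + 3 and n = dN + d - 1. Over ℚ the modulus is a product of pairwise coprime factors:
Φ_n^4, and Φ_m for each m ∣ n with m ≠ 1, n (`modulus_dvd`). It suffices to work in the local ring
at each Φ_m, where 1 - q is a unit, so the sum may be multiplied by it.

Simple factors (`sum_vwpTerm_mem`): modulo Φ_m one has q^m = 1. Let i₀ < m satisfy m ∣ d i₀ + 1. The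
terms are antisymmetric under k ↦ i₀ - k, those with i₀ < k < m vanish, and term am + b is term b
times a constant depending only on a. So every block sums to zero.

Fourth power (`pow_four_dvd_sum_vwpTerm`): let F_k(x) = ∏_{j<k} (1 - q^(dj+1) x) / (x - q^(d(j+1))).
Up to 1 - q the summand is (1 - q^(2dk+1)) F_k(1)^(2d) q^(d(d-2)k). Replace the 2d arguments 1 by 1,
q^(-(d-1)n), e₁ pairs (q^(2n), q^(-n)) and e₂ pairs (q^n, 1), where e₁ + e₂ = d - 1. By Lagrange
interpolation the deformed sum, up to k = ((d-1)n - 1)/d, is exactly zero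
(`sum_karlssonMinton_eq_zero`). Modulo Φ_n^4 put q^n = exp(l) with l^4 = 0 and expand
(`sum_vwp_expansion`). The linear terms cancel because the exponents of q^n add up to 0. The cubic
term is l^3 times a sum of antisymmetric times symmetric terms, hence zero. What remains is S +
(coefficient)·c = 0, with c independent of e₁, e₂; two choices of (e₁, e₂) force c = 0, hence S = 0.
-/

namespace QCong
open Finset

/-! ### Truncated exponentials and logarithms. -/

/-- The exponential of `l * b`, truncated after the cubic term; `r` plays the role of `1 / 6`. -/
def truncExp {B : Type*} [CommRing B] (r l b : B) : B :=
  1 + l * b + 3 * r * l ^ 2 * b ^ 2 + r * l ^ 3 * b ^ 3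

section TruncExp
variable {B : Type*} [CommRing B] {r l : B}

theorem truncExp_zero : truncExp r l 0 = 1 := by simp [truncExp]

theorem truncExp_add (hr : 6 * r = 1) (hl : l ^ 4 = 0) (a b : B) :
    truncExp r l (a + b) = truncExp r l a * truncExp r l b := by
  unfold truncExp
  grind

/-- Taylor expansion of log(1 - u exp(lt)) in terms of i = 1/(1 - u), using u/(1 - u) = i - 1. One
factor l is taken out because `truncExp` supplies it. -/
theorem one_sub_mul_truncExp (hr : 6 * r = 1) (hl : l ^ 4 = 0) {u i : B} (hi : (1 - u) * i = 1)
    (t : B) :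
    1 - u * truncExp r l t = (1 - u) * truncExp r l
      ((1 - i) * t - 3 * r * (i ^ 2 - i) * t ^ 2 * l - r * ((i - 1) * (2 * i - 1) * i) * t ^ 3 * l ^ 2) := by
  have key : i - (i - 1) * truncExp r l t = truncExp r l
      ((1 - i) * t - 3 * r * (i ^ 2 - i) * t ^ 2 * l - r * ((i - 1) * (2 * i - 1) * i) * t ^ 3 * l ^ 2) := by
    unfold truncExp
    grind
  rw [← key]
  linear_combination (truncExp r l t - 1) * hi

end TruncExp

/-- The factor `∏ (1 - x q ^ (d j + 1)) / (x - q ^ (d (j + 1)))` of a very-well-poised summand. -/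
noncomputable def vwpFactor {R : Type*} [CommRing R] (q : R) (d : ℕ) (x : R) (k : ℕ) : R :=
  ∏ j ∈ range k, ((1 - q ^ (d * j + 1) * x) * Ring.inverse (x - q ^ (d * (j + 1))))

/-- The cubic coefficient of `log (1 - u * exp t)`, as a function of `i = (1 - u)⁻¹`. -/
def logCubic {R : Type*} [CommRing R] (r i : R) : R :=
  -(r * ((i - 1) * (2 * i - 1) * i))

/-- The cubic coefficient of `log (vwpFactor q d (exp t) k)`. -/
noncomputable def vwpCubic {R : Type*} [CommRing R] (r q : R) (d k : ℕ) : R :=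
  ∑ j ∈ range k, (logCubic r (Ring.inverse (1 - q ^ (d * j + 1))) +
    logCubic r (Ring.inverse (1 - q ^ (d * (j + 1)))))

section Expansion
variable {B : Type*} [CommRing B] {r l : B}

theorem truncExp_mul_neg (hr : 6 * r = 1) (hl : l ^ 4 = 0) (a : B) :
    truncExp r l a * truncExp r l (-a) = 1 := by
  rw [← truncExp_add hr hl, add_neg_cancel, truncExp_zero]

theorem inverse_mul_truncExp (hr : 6 * r = 1) (hl : l ^ 4 = 0) (u a : B) :
    Ring.inverse (u * truncExp r l a) = Ring.inverse u * truncExp r l (-a) := by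
  have h := truncExp_mul_neg hr hl a
  have hu : IsUnit (truncExp r l a) := IsUnit.of_mul_eq_one _ h
  rw [Ring.inverse_mul (Or.inr hu), mul_comm]
  congr 1
  rw [← mul_one (Ring.inverse _), Ring.inverse_mul_eq_iff_eq_mul _ _ _ hu, h]

theorem truncExp_sub_eq (hr : 6 * r = 1) (hl : l ^ 4 = 0) {v i : B} (hi : (1 - v) * i = 1)
    (t : B) :
    truncExp r l t - v = (1 - v) * truncExp r l
      (i * t - 3 * r * (i ^ 2 - i) * t ^ 2 * l - logCubic r i * t ^ 3 * l ^ 2) := by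
  have h1 := truncExp_mul_neg hr hl t
  have h2 := one_sub_mul_truncExp hr hl hi (-t)
  have h3 : truncExp r l t - v = truncExp r l t * (1 - v * truncExp r l (-t)) := by
    linear_combination v * h1
  rw [h3, h2, mul_left_comm, ← truncExp_add hr hl]
  congr 2
  unfold logCubic
  ring

/-- Logarithms of the factors add up. Only the cubic coefficient is made explicit, since its
symmetry is needed; the linear one will cancel and the quadratic one will be eliminated. -/
theorem exists_vwpFactor_truncExp (hr : 6 * r = 1) (hl : l ^ 4 = 0) (q : B) (d k : ℕ)
    (h1 : ∀ j < k, IsUnit (1 - q ^ (d * j + 1))) (h2 : ∀ j < k, IsUnit (1 - q ^ (d * (j + 1)))) :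
    ∃ a b : B, ∀ t : B, vwpFactor q d (truncExp r l t) k =
      vwpFactor q d 1 k * truncExp r l (a * t + b * t ^ 2 * l + vwpCubic r q d k * t ^ 3 * l ^ 2) := by
  induction k with
  | zero => exact ⟨0, 0, fun t => by simp [vwpFactor, vwpCubic, truncExp_zero]⟩
  | succ k ih =>
    obtain ⟨a, b, hab⟩ := ih (fun j hj => h1 j (by omega)) (fun j hj => h2 j (by omega))
    have hi := Ring.mul_inverse_cancel _ (h1 k (by omega))
    have hi' := Ring.mul_inverse_cancel _ (h2 k (by omega))
    have hc : vwpCubic r q d (k + 1) = vwpCubic r q d k +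
        (logCubic r (Ring.inverse (1 - q ^ (d * k + 1))) +
          logCubic r (Ring.inverse (1 - q ^ (d * (k + 1))))) := sum_range_succ _ _
    have hf : ∀ x, vwpFactor q d x (k + 1) = vwpFactor q d x k *
        ((1 - q ^ (d * k + 1) * x) * Ring.inverse (x - q ^ (d * (k + 1)))) :=
      fun x => prod_range_succ _ _
    simp only [hf, hab, hc]
    generalize vwpCubic r q d k = g
    set i := Ring.inverse (1 - q ^ (d * k + 1))
    set i' := Ring.inverse (1 - q ^ (d * (k + 1)))
    refine ⟨a + (1 - i) - i', b - 3 * r * (i ^ 2 - i) + 3 * r * (i' ^ 2 - i'), fun t => ?_⟩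
    rw [one_sub_mul_truncExp hr hl hi, truncExp_sub_eq hr hl hi', inverse_mul_truncExp hr hl,
      mul_one, show Ring.inverse (1 - q ^ (d * (k + 1))) = i' from rfl]
    have hs : a * t + b * t ^ 2 * l + g * t ^ 3 * l ^ 2 +
        ((1 - i) * t - 3 * r * (i ^ 2 - i) * t ^ 2 * l -
          r * ((i - 1) * (2 * i - 1) * i) * t ^ 3 * l ^ 2) +
        -(i' * t - 3 * r * (i' ^ 2 - i') * t ^ 2 * l - logCubic r i' * t ^ 3 * l ^ 2) =
        (a + (1 - i) - i') * t + (b - 3 * r * (i ^ 2 - i) + 3 * r * (i' ^ 2 - i')) * t ^ 2 * l +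
          (g + (logCubic r i + logCubic r i')) * t ^ 3 * l ^ 2 := by
      simp only [logCubic]; ring
    rw [← hs]
    simp only [truncExp_add hr hl]
    ring

end Expansion

/-! ### The reflection k ↦ M - k when q^(dM+1) = 1. -/

section Antisymmetry
variable {R : Type*} [CommRing R]

/-- The summand of the theorem, multiplied by `1 - q`. -/
noncomputable def vwpTerm (q : R) (d k : ℕ) : R :=
  (1 - q ^ (2 * d * k + 1)) * vwpFactor q d 1 k ^ (2 * d) * q ^ (d * (d - 2) * k)

/-- Since q^(dk+1) is inverse to q^(d(M-k)), one has 1 - q^(dk+1) = -q^(dk+1) (1 - q^(d(M-k))). Up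
to sign and a power of q the product is therefore a q^d-binomial coefficient. -/
theorem vwpFactor_one_mul (q : R) (d M : ℕ) (hq : q ^ (d * M + 1) = 1)
    (hu : ∀ j < M, IsUnit (1 - q ^ (d * (j + 1)))) (k k' : ℕ) (hk : k + k' = M) :
    vwpFactor q d 1 k * ((∏ j ∈ range k, (1 - q ^ (d * (j + 1)))) *
      ∏ j ∈ range k', (1 - q ^ (d * (j + 1)))) =
    (-1) ^ k * q ^ (k + d * k.choose 2) * ∏ j ∈ range M, (1 - q ^ (d * (j + 1))) := by
  induction k generalizing k' with
  | zero =>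
    obtain rfl : k' = M := by omega
    simp [vwpFactor]
  | succ k ih =>
    have h := ih (k' + 1) (by omega)
    rw [prod_range_succ _ k'] at h
    have hf : vwpFactor q d 1 (k + 1) = vwpFactor q d 1 k *
        ((1 - q ^ (d * k + 1) * 1) * Ring.inverse (1 - q ^ (d * (k + 1)))) := prod_range_succ _ _
    rw [hf, prod_range_succ _ k]
    have hi := Ring.mul_inverse_cancel _ (hu k (by omega))
    have hch : (k + 1).choose 2 = k + k.choose 2 := by
      rw [Nat.choose_succ_succ' k 1, Nat.choose_one_right]
    have e1 : q ^ (d * k + 1) * q ^ (d * (k' + 1)) = 1 := by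
      rw [← pow_add, ← hq, ← hk]; congr 1; ring
    have e2 : q ^ (k + 1 + d * (k + k.choose 2)) = q ^ (d * k + 1) * q ^ (k + d * k.choose 2) := by
      rw [← pow_add]; congr 1; ring
    rw [hch, e2, mul_one]
    generalize Ring.inverse (1 - q ^ (d * (k + 1))) = i at *
    generalize ∏ j ∈ range k, (1 - q ^ (d * (j + 1))) = P1 at *
    generalize ∏ j ∈ range k', (1 - q ^ (d * (j + 1))) = P2 at *
    generalize ∏ j ∈ range M, (1 - q ^ (d * (j + 1))) = P3 at *
    generalize q ^ (d * (k' + 1)) = u at *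
    generalize q ^ (d * k + 1) = v at *
    generalize q ^ (d * (k + 1)) = z at *
    linear_combination (vwpFactor q d 1 k * (1 - v) * P1 * P2) * hi - v * h
      + (- vwpFactor q d 1 k * P1 * P2) * e1

/-- Clearing a denominator symmetric in k and k' leaves (1 - q^(2dk+1)) q^((dk)^2) times a common
factor; with X = q^(dk), Y = q^(dk') and qXY = 1 the swap changes its sign. -/
theorem vwpTerm_antisymm (q : R) (d M : ℕ) (hd : 2 ≤ d) (hq : q ^ (d * M + 1) = 1)
    (hu : ∀ j < M, IsUnit (1 - q ^ (d * (j + 1)))) (k k' : ℕ) (hk : k + k' = M) :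
    vwpTerm q d k' = - vwpTerm q d k := by
  have hP : ∀ k ≤ M, IsUnit (∏ j ∈ range k, (1 - q ^ (d * (j + 1)))) := fun k hk =>
    IsUnit.prod_iff.2 fun j hj => hu j (by have := mem_range.1 hj; omega)
  set D := (∏ j ∈ range k, (1 - q ^ (d * (j + 1)))) * ∏ j ∈ range k', (1 - q ^ (d * (j + 1)))
    with hD
  have hDu : IsUnit (D ^ (2 * d)) := ((hP k (by omega)).mul (hP k' (by omega))).pow _
  set P := ∏ j ∈ range M, (1 - q ^ (d * (j + 1)))
  have key : ∀ k, vwpFactor q d 1 k * D = (-1) ^ k * q ^ (k + d * k.choose 2) * P →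
      vwpTerm q d k * D ^ (2 * d) = (1 - q ^ (2 * d * k + 1)) * q ^ (d * k * (d * k)) * P ^ (2 * d) := by
    intro k h
    have hs : vwpFactor q d 1 k ^ (2 * d) * D ^ (2 * d) =
        q ^ ((k + d * k.choose 2) * (2 * d)) * P ^ (2 * d) := by
      rw [← mul_pow, h, mul_pow, mul_pow, ← pow_mul, ← pow_mul, mul_comm k (2 * d), pow_mul (-1 : R),
        pow_mul (-1 : R), neg_one_sq, one_pow, one_pow, one_mul]
    -- The power q^(d(d-2)k) in the summand is exactly what completes the exponent to the square
    -- (dk)^2.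
    have he : (k + d * k.choose 2) * (2 * d) + d * (d - 2) * k = d * k * (d * k) := by
      obtain ⟨c, rfl⟩ := Nat.exists_eq_add_of_le hd
      have h2 : k.choose 2 * 2 + k = k * k := by
        rw [Nat.choose_two_right, Nat.div_mul_cancel (Nat.even_mul_pred_self k).two_dvd]
        cases k with
        | zero => rfl
        | succ k => simp; ring
      rw [Nat.add_sub_cancel_left]
      linear_combination (2 + c) * (2 + c) * h2
    rw [vwpTerm, ← he, pow_add]
    linear_combination ((1 - q ^ (2 * d * k + 1)) * q ^ (d * (d - 2) * k)) * hs
  have h1 := key k (vwpFactor_one_mul q d M hq hu k k' hk)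
  have h2 := key k' (by rw [hD, mul_comm (∏ j ∈ range k, _)]
                        exact vwpFactor_one_mul q d M hq hu k' k (by omega))
  refine hDu.mul_left_injective ?_
  simp only
  rw [neg_mul, h1, h2]
  have eX : ∀ k, q ^ (2 * d * k + 1) = q * q ^ (d * k) * q ^ (d * k) := fun k => by
    rw [show 2 * d * k + 1 = 1 + d * k + d * k by ring, pow_add, pow_add, pow_one]
  have e1 : q * q ^ (d * k) * q ^ (d * k') = 1 := by
    rw [mul_assoc, ← pow_add, ← pow_succ', ← hq, ← hk]; congr 1; ring
  -- Both sides are the inverse of q^(dk·dk').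
  have e2 : q ^ (d * k' * (d * k')) * q ^ (d * k') = q ^ (d * k * (d * k)) * q ^ (d * k) := by
    have a1 : q ^ (d * k' * (d * k')) * q ^ (d * k') * q ^ (d * k * (d * k')) = 1 := by
      rw [← one_pow (d * k'), ← hq, ← hk, ← pow_mul, ← pow_add, ← pow_add]; congr 1; ring
    have a2 : q ^ (d * k * (d * k)) * q ^ (d * k) * q ^ (d * k * (d * k')) = 1 := by
      rw [← one_pow (d * k), ← hq, ← hk, ← pow_mul, ← pow_add, ← pow_add]; congr 1; ring
    exact (IsUnit.of_mul_eq_one_right _ a1).mul_left_injective (a1.trans a2.symm)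
  rw [eX, eX]
  generalize q ^ (d * k' * (d * k')) = E' at *
  generalize q ^ (d * k * (d * k)) = E at *
  generalize q ^ (d * k) = X at *
  generalize q ^ (d * k') = Y at *
  linear_combination (-(E' + E) * P ^ (2 * d)) * e1 + (q * (X - Y)) * P ^ (2 * d) * e2

/-- `logCubic` is odd under i ↦ 1 - i, which is u ↦ 1/u for i = 1/(1 - u). So numerator
contributions become reflected denominator contributions with opposite sign. -/
theorem vwpCubic_symm (r q : R) (d M : ℕ) (hq : q ^ (d * M + 1) = 1)
    (hu : ∀ j < M, IsUnit (1 - q ^ (d * (j + 1)))) (k k' : ℕ) (hk : k + k' = M) :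
    vwpCubic r q d k' = vwpCubic r q d k := by
  set G : ℕ → R := fun j => logCubic r (Ring.inverse (1 - q ^ (d * (j + 1))))
  have key : ∀ k k', k + k' = M →
      vwpCubic r q d k = ∑ j ∈ range k, G j + ∑ j ∈ range k', G j - ∑ j ∈ range M, G j := by
    intro k
    induction k with
    | zero =>
      intro k' hk
      obtain rfl : k' = M := by omega
      simp [vwpCubic]
    | succ k ih =>
      intro k' hk
      have h := ih (k' + 1) (by omega)
      have hc : vwpCubic r q d (k + 1) = vwpCubic r q d k +
          (logCubic r (Ring.inverse (1 - q ^ (d * k + 1))) + G k) := sum_range_succ _ _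
      rw [hc, h, sum_range_succ, sum_range_succ]
      have hi' := Ring.mul_inverse_cancel _ (hu k' (by omega))
      have e1 : q ^ (d * k + 1) * q ^ (d * (k' + 1)) = 1 := by
        rw [← pow_add, ← hq, ← hk]; congr 1; ring
      have hv : (1 - q ^ (d * k + 1)) * (1 - Ring.inverse (1 - q ^ (d * (k' + 1)))) = 1 := by
        linear_combination Ring.inverse (1 - q ^ (d * (k' + 1))) * e1 + q ^ (d * k + 1) * hi'
      have hv' : Ring.inverse (1 - q ^ (d * k + 1)) = 1 - Ring.inverse (1 - q ^ (d * (k' + 1))) := by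
        rw [← mul_one (Ring.inverse _), Ring.inverse_mul_eq_iff_eq_mul _ _ _ (IsUnit.of_mul_eq_one _ hv),
          hv]
      have : logCubic r (Ring.inverse (1 - q ^ (d * k + 1))) = - G k' := by
        rw [hv']; simp only [G, logCubic]; ring
      rw [this]; ring
  rw [key k k' hk, key k' k (by omega)]; ring

theorem sum_mul_eq_zero_of_antisymm {r : R} (hr : 6 * r = 1) {M : ℕ} {f g : ℕ → R}
    (hf : ∀ k k', k + k' = M → f k' = -f k) (hg : ∀ k k', k + k' = M → g k' = g k) :
    ∑ k ∈ range (M + 1), f k * g k = 0 := by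
  have h : ∑ k ∈ range (M + 1), f k * g k = -∑ k ∈ range (M + 1), f k * g k := by
    conv_lhs => rw [← sum_range_reflect]
    rw [← sum_neg_distrib]
    refine sum_congr rfl fun k hk => ?_
    have := mem_range.1 hk
    rw [hf k (M + 1 - 1 - k) (by omega), hg k (M + 1 - 1 - k) (by omega)]; ring
  linear_combination (-(∑ k ∈ range (M + 1), f k * g k)) * hr + 3 * r * h

end Antisymmetry

/-! ### Lagrange interpolation at the nodes q^(-dk) + q^(dk+1). -/

section Lagrange
variable {K : Type*} [Field K]

theorem vwpFactor_eq_div (q : K) (d : ℕ) (x : K) (k : ℕ) :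
    vwpFactor q d x k = (∏ j ∈ range k, (1 - q ^ (d * j + 1) * x)) /
      ∏ j ∈ range k, (x - q ^ (d * (j + 1))) := by
  simp [vwpFactor, prod_mul_distrib, div_eq_mul_inv]

theorem pow_mul_prod_range (a : K) (f : ℕ → K) (k : ℕ) :
    a ^ k * ∏ j ∈ range k, f j = ∏ j ∈ range k, a * f j := by
  simp [prod_mul_distrib]

/-- The sum is c times the coefficient of X^M in the Lagrange interpolant of P, which is P itself.
-/
theorem sum_eval_mul_eq_zero {M : ℕ} {v : ℕ → K} (hv : Set.InjOn v (range (M + 1))) {f : ℕ → K}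
    {c : K} (hf : ∀ k ∈ range (M + 1), f k * ∏ j ∈ (range (M + 1)).erase k, (v k - v j) = c)
    {P : Polynomial K} (hP : P.natDegree < M) :
    ∑ k ∈ range (M + 1), f k * P.eval (v k) = 0 := by
  have hdeg : P.degree < #(range (M + 1)) := by
    rw [card_range]
    exact Polynomial.degree_le_natDegree.trans_lt (by exact_mod_cast hP.trans (Nat.lt_succ_self M))
  have h := Lagrange.coeff_eq_sum hv hdeg
  rw [card_range, Nat.add_sub_cancel, Polynomial.coeff_eq_zero_of_natDegree_lt hP] at h
  have hne : ∀ k ∈ range (M + 1), ∏ j ∈ (range (M + 1)).erase k, (v k - v j) ≠ 0 := by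
    intro k hk
    refine prod_ne_zero_iff.2 fun j hj => sub_ne_zero.2 fun he => ?_
    exact (ne_of_mem_erase hj) (hv (mem_of_mem_erase hj) hk he.symm)
  rw [← mul_zero c, h, mul_sum]
  refine sum_congr rfl fun k hk => ?_
  rw [← hf k hk]
  have := hne k hk
  field_simp

theorem prod_range_erase_eq (f : ℕ → K) (k k' : ℕ) :
    ∏ j ∈ (range (k + k' + 1)).erase k, f j =
      (∏ j ∈ range k, f j) * ∏ i ∈ range k', f (k + 1 + i) := by
  have : (range (k + k' + 1)).erase k = range k ∪ (range k').map (addLeftEmbedding (k + 1)) := by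
    ext j
    simp only [mem_erase, mem_range, mem_union, mem_map, addLeftEmbedding_apply]
    constructor
    · intro h
      rcases lt_or_ge j k with h1 | h1
      · exact Or.inl h1
      · exact Or.inr ⟨j - (k + 1), by omega, by omega⟩
    · rintro (h | ⟨a, h, rfl⟩) <;> omega
  rw [this, prod_union, prod_map]
  · rfl
  · rw [disjoint_left]
    simp only [mem_range, mem_map, addLeftEmbedding_apply, not_exists, not_and]
    intros; omega

theorem prod_shift_mul (f : ℕ → K) (L k : ℕ) :
    (∏ j ∈ range L, f (k + j)) * ∏ j ∈ range k, f j =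
      (∏ j ∈ range L, f j) * ∏ j ∈ range k, f (L + j) := by
  rw [← prod_range_add f L k, add_comm L k, prod_range_add f k L, mul_comm]

/-- Identifies the unpaired part of the deformed summand, with w = q^(-(dM+1)), as an interpolation
weight. It works because the node differences factor as (1 - q^(d(k+j)+1)) (q^(-dk) - q^(-dj)). -/
theorem lagrange_weight (q u w : K) (d M : ℕ) (hu : q * u = 1) (hw : q ^ (d * M + 1) * w = 1)
    (h1 : ∀ j, q ^ (d * (j + 1)) ≠ 1) (h2 : ∀ j, w ≠ q ^ (d * (j + 1))) :
    ∃ c, ∀ k ∈ range (M + 1), (1 - q ^ (2 * d * k + 1)) * vwpFactor q d 1 k * vwpFactor q d w k *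
      u ^ k * ∏ j ∈ (range (M + 1)).erase k,
        ((u ^ (d * k) + q ^ (d * k + 1)) - (u ^ (d * j) + q ^ (d * j + 1))) = c := by
  refine ⟨(∏ j ∈ range (M + 1), (1 - q ^ (d * j + 1))) * ∏ i ∈ range M, (1 - u ^ (d * (i + 1))),
    fun k hk => ?_⟩
  obtain ⟨k', rfl⟩ := Nat.exists_eq_add_of_le (Nat.lt_succ_iff.1 (mem_range.1 hk))
  have hpow : ∀ a, q ^ a * u ^ a = 1 := fun a => by rw [← mul_pow, hu, one_pow]
  -- split the product of differences of nodes
  have hsplit : (1 - q ^ (2 * d * k + 1)) * ∏ j ∈ (range (k + k' + 1)).erase k,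
        ((u ^ (d * k) + q ^ (d * k + 1)) - (u ^ (d * j) + q ^ (d * j + 1))) =
      (∏ j ∈ range (k + k' + 1), (1 - q ^ (d * (k + j) + 1))) *
        ((∏ j ∈ range k, (u ^ (d * k) - u ^ (d * j))) *
          ∏ i ∈ range k', (u ^ (d * k) - u ^ (d * (k + 1 + i)))) := by
    have hfac : ∀ j, (u ^ (d * k) + q ^ (d * k + 1)) - (u ^ (d * j) + q ^ (d * j + 1)) =
        (1 - q ^ (d * (k + j) + 1)) * (u ^ (d * k) - u ^ (d * j)) := by
      intro j
      have e1 := hpow (d * k)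
      have e2 := hpow (d * j)
      have e3 : q ^ (d * (k + j) + 1) = q * q ^ (d * k) * q ^ (d * j) := by ring
      rw [e3, pow_succ, pow_succ]
      linear_combination q * q ^ (d * j) * e1 - q * q ^ (d * k) * e2
    rw [← mul_prod_erase (range (k + k' + 1)) (fun j => 1 - q ^ (d * (k + j) + 1)) hk,
      ← prod_range_erase_eq (fun j => u ^ (d * k) - u ^ (d * j)), prod_congr rfl fun j _ => hfac j,
      prod_mul_distrib, ← mul_assoc]
    congr 3
    ring
  have hE := prod_shift_mul (fun j => 1 - q ^ (d * j + 1)) (k + k' + 1) k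
  have ha : ∏ j ∈ range k, (u ^ (d * k) - u ^ (d * j)) =
      u ^ (d * k * k) * ∏ j ∈ range k, (1 - q ^ (d * (j + 1))) := by
    rw [← prod_range_reflect, pow_mul u (d * k) k, pow_mul_prod_range]
    refine prod_congr rfl fun j hj => ?_
    have hj := mem_range.1 hj
    have e : u ^ (d * k) = u ^ (d * (k - 1 - j)) * u ^ (d * (j + 1)) := by
      rw [← pow_add, ← mul_add]; congr 2; omega
    rw [e]
    linear_combination u ^ (d * (k - 1 - j)) * hpow (d * (j + 1))
  have hb : ∏ i ∈ range k', (u ^ (d * k) - u ^ (d * (k + 1 + i))) =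
      u ^ (d * k * k') * ∏ i ∈ range k', (1 - u ^ (d * (i + 1))) := by
    rw [pow_mul u (d * k) k', pow_mul_prod_range]
    refine prod_congr rfl fun j hj => ?_
    rw [mul_sub, mul_one, ← pow_add]; congr 2; ring
  have hc : (∏ j ∈ range k, (1 - q ^ (d * j + 1) * w)) * ∏ i ∈ range k', (1 - u ^ (d * (i + 1))) =
      ∏ i ∈ range (k + k'), (1 - u ^ (d * (i + 1))) := by
    rw [add_comm k k', prod_range_add, mul_comm, ← prod_range_reflect _ k]
    congr 1
    refine prod_congr rfl fun j hj => ?_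
    have hj := mem_range.1 hj
    have e1 : q ^ (d * (k - 1 - j) + 1) * w * q ^ (d * (k' + j + 1)) = 1 := by
      rw [mul_right_comm, ← pow_add, ← hw]
      congr 2
      obtain ⟨a, rfl⟩ : ∃ a, k = a + j + 1 := ⟨k - 1 - j, by omega⟩
      rw [show a + j + 1 - 1 - j = a by omega]
      ring
    have e2 := hpow (d * (k' + j + 1))
    have : q ^ (d * (k - 1 - j) + 1) * w = u ^ (d * (k' + j + 1)) := by
      linear_combination (u ^ (d * (k' + j + 1))) * e1 -
        q ^ (d * (k - 1 - j) + 1) * w * e2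
    rw [this]
  have hden : ∏ j ∈ range k, (w - q ^ (d * (j + 1))) =
      w ^ k * ∏ j ∈ range k, (1 - q ^ (d * (k + k' + 1 + j) + 1)) := by
    rw [pow_mul_prod_range]
    refine prod_congr rfl fun j hj => ?_
    have e : q ^ (d * (k + k' + 1 + j) + 1) = q ^ (d * (k + k') + 1) * q ^ (d * (j + 1)) := by
      rw [← pow_add]; congr 1; ring
    rw [e]
    linear_combination q ^ (d * (j + 1)) * hw
  have hQ : ∏ j ∈ range k, (1 - q ^ (d * (j + 1))) ≠ 0 :=
    prod_ne_zero_iff.2 fun j _ => sub_ne_zero.2 (h1 j).symm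
  have hW : ∏ j ∈ range k, (w - q ^ (d * (j + 1))) ≠ 0 :=
    prod_ne_zero_iff.2 fun j _ => sub_ne_zero.2 (h2 j)
  have hz : u ^ (d * k * k) * u ^ (d * k * k') * u ^ k = w ^ k := by
    have e1 := hpow ((d * (k + k') + 1) * k)
    have e2 : (q ^ ((d * (k + k') + 1) * k)) * w ^ k = 1 := by
      rw [pow_mul, ← mul_pow, hw, one_pow]
    have e3 : u ^ (d * k * k) * u ^ (d * k * k') * u ^ k = u ^ ((d * (k + k') + 1) * k) := by
      rw [← pow_add, ← pow_add]; congr 1; ring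
    rw [e3]
    linear_combination w ^ k * e1 - u ^ ((d * (k + k') + 1) * k) * e2
  rw [vwpFactor_eq_div, vwpFactor_eq_div]
  simp only [mul_one]
  rw [ha, hb] at hsplit
  rw [← hc, div_eq_mul_inv, div_eq_mul_inv]
  have i1 := mul_inv_cancel₀ hQ
  have i2 := mul_inv_cancel₀ hW
  have hE' : (∏ j ∈ range (k + k' + 1), (1 - q ^ (d * (k + j) + 1))) *
      (∏ j ∈ range k, (1 - q ^ (d * j + 1))) * w ^ k =
      (∏ j ∈ range (k + k' + 1), (1 - q ^ (d * j + 1))) *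
        ∏ j ∈ range k, (w - q ^ (d * (j + 1))) := by
    rw [hden, hE]; ring
  generalize (∏ j ∈ range k, (w - q ^ (d * (j + 1))))⁻¹ = I2 at *
  generalize (∏ j ∈ range k, (1 - q ^ (d * (j + 1))))⁻¹ = I1 at *
  generalize ∏ j ∈ range k, (w - q ^ (d * (j + 1))) = A2 at *
  generalize ∏ j ∈ range k, (1 - q ^ (d * (j + 1))) = A1 at *
  generalize ∏ j ∈ range (k + k' + 1), (1 - q ^ (d * (k + j) + 1)) = Ek at *
  generalize ∏ j ∈ range (k + k' + 1), (1 - q ^ (d * j + 1)) = E0 at *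
  generalize ∏ j ∈ range k, (1 - q ^ (d * j + 1)) = F at *
  generalize ∏ j ∈ range k, (1 - q ^ (d * j + 1) * w) = G at *
  generalize ∏ i ∈ range k', (1 - u ^ (d * (i + 1))) = H at *
  calc _ = ((1 - q ^ (2 * d * k + 1)) * ∏ j ∈ (range (k + k' + 1)).erase k,
        ((u ^ (d * k) + q ^ (d * k + 1)) - (u ^ (d * j) + q ^ (d * j + 1)))) *
          (F * I1 * (G * I2) * u ^ k) := by ring
    _ = (Ek * F * (u ^ (d * k * k) * u ^ (d * k * k') * u ^ k)) * (A1 * I1) * I2 * G * H := by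
      rw [hsplit]; ring
    _ = E0 * (G * H) * (A2 * I2) := by rw [hz, mul_assoc Ek, ← mul_assoc Ek, hE', i1]; ring
    _ = _ := by rw [i2, mul_one]

/-- The numerator for x telescopes against the denominator for x', leaving a ratio of products of N
factors. Pairing factor l of one product with factor N - 1 - l of the other gives q^(dk) times a
linear polynomial in the node. -/
theorem vwpFactor_pair (q u x x' : K) (d N : ℕ) (hu : q * u = 1) (hx : x * x' * q = q ^ (d * (N + 1)))
    (hx0 : x ≠ 0) (hx0' : x' ≠ 0)
    (h1 : ∀ j, x ≠ q ^ (d * (j + 1))) (h2 : ∀ j, x' ≠ q ^ (d * (j + 1))) :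
    ∃ P : Polynomial K, P.natDegree ≤ N ∧ ∀ k, vwpFactor q d x k * vwpFactor q d x' k =
      ((x * x')⁻¹ * q ^ (d * N)) ^ k * P.eval (u ^ (d * k) + q ^ (d * k + 1)) := by
  set c := q ^ d * x'⁻¹ with hc
  set c' := q ^ d * x⁻¹ with hc'
  set H : K → ℕ → K := fun c k => ∏ l ∈ range N, (1 - c * q ^ (d * (k + l)))
  have hpow : ∀ a, q ^ a * u ^ a = 1 := fun a => by rw [← mul_pow, hu, one_pow]
  have hq : q ≠ 0 := left_ne_zero_of_mul_eq_one hu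
  have cx : c * x' = q ^ d := by rw [hc, mul_assoc, inv_mul_cancel₀ hx0', mul_one]
  have cx' : c' * x = q ^ d := by rw [hc', mul_assoc, inv_mul_cancel₀ hx0, mul_one]
  have den : ∀ {c x : K}, c * x = q ^ d → ∀ j, x - q ^ (d * (j + 1)) = x * (1 - c * q ^ (d * j)) := by
    intro c x h j
    rw [mul_add, mul_one, pow_add, ← h]; ring
  have hne : ∀ {c x : K}, c * x = q ^ d → (∀ j, x ≠ q ^ (d * (j + 1))) →
      ∀ j, 1 - c * q ^ (d * j) ≠ 0 := by
    intro c x h h1 j h0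
    have := den h j
    rw [h0, mul_zero, sub_eq_zero] at this
    exact h1 j this
  have hH0 : H c 0 * H c' 0 ≠ 0 := by
    refine mul_ne_zero ?_ ?_
    · exact prod_ne_zero_iff.2 fun l _ => by rw [zero_add]; exact hne cx h2 l
    · exact prod_ne_zero_iff.2 fun l _ => by rw [zero_add]; exact hne cx' h1 l
  have hstep : ∀ c k, H c (k + 1) * (1 - c * q ^ (d * k)) = H c k * (1 - c * q ^ (d * (k + N))) := by
    intro c k
    have h1 := prod_range_succ (fun l => 1 - c * q ^ (d * (k + l))) N
    have h2 := prod_range_succ' (fun l => 1 - c * q ^ (d * (k + l))) N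
    rw [h1, add_zero] at h2
    rw [h2]
    congr 1
    refine prod_congr rfl fun l _ => ?_
    rw [show k + 1 + l = k + (l + 1) by ring]
  have hg : ∀ k, vwpFactor q d x k * vwpFactor q d x' k * (H c 0 * H c' 0) =
      (x * x')⁻¹ ^ k * (H c k * H c' k) := by
    intro k
    induction k with
    | zero => simp [vwpFactor]
    | succ k ih =>
      have hf : ∀ x, vwpFactor q d x (k + 1) = vwpFactor q d x k *
        ((1 - q ^ (d * k + 1) * x) * (x - q ^ (d * (k + 1)))⁻¹) := fun x => by
          rw [vwpFactor, prod_range_succ, Ring.inverse_eq_inv]; rfl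
      have n1 : 1 - q ^ (d * k + 1) * x = 1 - c * q ^ (d * (k + N)) := by
        have : q ^ (d * k + 1) * x * x' = c * q ^ (d * (k + N)) * x' := by
          calc _ = q ^ (d * k) * (x * x' * q) := by ring
            _ = (c * x') * q ^ (d * (k + N)) := by rw [hx, cx, ← pow_add, ← pow_add]; congr 1; ring
            _ = _ := by ring
        rw [mul_right_cancel₀ hx0' this]
      have n2 : 1 - q ^ (d * k + 1) * x' = 1 - c' * q ^ (d * (k + N)) := by
        have : q ^ (d * k + 1) * x' * x = c' * q ^ (d * (k + N)) * x := by
          calc _ = q ^ (d * k) * (x * x' * q) := by ring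
            _ = (c' * x) * q ^ (d * (k + N)) := by rw [hx, cx', ← pow_add, ← pow_add]; congr 1; ring
            _ = _ := by ring
        rw [mul_right_cancel₀ hx0 this]
      have s1 := hstep c k
      have s2 := hstep c' k
      have m1 := hne cx h2 k
      have m2 := hne cx' h1 k
      rw [hf, hf, n1, n2, den cx k, den cx' k]
      have t1 : H c (k + 1) = H c k * (1 - c * q ^ (d * (k + N))) * (1 - c * q ^ (d * k))⁻¹ := by
        rw [← s1, mul_assoc, mul_inv_cancel₀ m1, mul_one]
      have t2 : H c' (k + 1) = H c' k * (1 - c' * q ^ (d * (k + N))) * (1 - c' * q ^ (d * k))⁻¹ := by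
        rw [← s2, mul_assoc, mul_inv_cancel₀ m2, mul_one]
      rw [t1, t2, pow_succ]
      simp only [mul_inv]
      rw [mul_inv] at ih
      linear_combination ((1 - c * q ^ (d * (k + N))) * (1 - c * q ^ (d * k))⁻¹ *
        (1 - c' * q ^ (d * (k + N))) * (1 - c' * q ^ (d * k))⁻¹ * x⁻¹ * x'⁻¹) * ih
  have hHH : ∀ k, H c k * H c' k = (q ^ (d * N)) ^ k * ∏ l ∈ range N,
      ((u ^ (d * k) + q ^ (d * k + 1)) - (c * q ^ (d * l) + c' * q ^ (d * (N - 1 - l)))) := by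
    intro k
    have : H c' k = ∏ l ∈ range N, (1 - c' * q ^ (d * (k + (N - 1 - l)))) :=
      (prod_range_reflect (fun l => 1 - c' * q ^ (d * (k + l))) N).symm
    rw [this, ← prod_mul_distrib, ← pow_mul, mul_right_comm, pow_mul]
    rw [pow_mul_prod_range]
    refine prod_congr rfl fun l hl => ?_
    have hl := mem_range.1 hl
    obtain ⟨a, ha⟩ : ∃ a, N = l + a + 1 := ⟨N - 1 - l, by omega⟩
    have hcc : c * c' * q ^ (d * l) * q ^ (d * (N - 1 - l)) = q := by
      rw [show N - 1 - l = a by omega]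
      have h3 : (x * x') ≠ 0 := mul_ne_zero hx0 hx0'
      apply mul_right_cancel₀ h3
      calc _ = (c * x') * (c' * x) * (q ^ (d * l) * q ^ (d * a)) := by ring
        _ = x * x' * q := by
          rw [cx, cx', hx, ha, ← pow_add, ← pow_add, ← pow_add]; congr 1; ring
        _ = _ := by ring
    have e1 := hpow (d * k)
    rw [mul_add d k l, mul_add d k (N - 1 - l), pow_add, pow_add, pow_succ]
    linear_combination q ^ (d * k) * q ^ (d * k) * hcc - e1
  refine ⟨Polynomial.C (H c 0 * H c' 0)⁻¹ * ∏ l ∈ range N, (Polynomial.X -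
    Polynomial.C (c * q ^ (d * l) + c' * q ^ (d * (N - 1 - l)))), ?_, fun k => ?_⟩
  · refine (Polynomial.natDegree_C_mul_le _ _).trans ?_
    rw [Polynomial.natDegree_prod_of_monic _ _ fun l _ => Polynomial.monic_X_sub_C _]
    simp only [Polynomial.natDegree_X_sub_C, sum_const, card_range, smul_eq_mul, mul_one, le_refl]
  · apply mul_right_cancel₀ hH0
    rw [hg, hHH, Polynomial.eval_mul, Polynomial.eval_prod, Polynomial.eval_C]
    simp only [Polynomial.eval_sub, Polynomial.eval_X, Polynomial.eval_C]
    rw [mul_pow]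
    generalize ∏ l ∈ range N, ((u ^ (d * k) + q ^ (d * k + 1)) -
      (c * q ^ (d * l) + c' * q ^ (d * (N - 1 - l)))) = Z
    rw [mul_assoc _ (_ * Z), mul_right_comm _ Z, inv_mul_cancel₀ hH0, one_mul, mul_assoc]

end Lagrange

/-! ### Exact vanishing of the deformed sum. -/

section KarlssonMinton
variable {K : Type*} [Field K]

/-- The d - 1 pairs contribute a polynomial of degree at most (d-1)N in the node, below M = (d-1)N +
d - 2. -/
theorem sum_karlssonMinton_eq_zero (q z : K) (hq : ∀ j, j ≠ 0 → q ^ j ≠ 1) (r N e₁ e₂ : ℕ)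
    (he : e₁ + e₂ = r + 2) (hz : z * q ^ ((r + 3) * N + r + 2) = 1) :
    ∑ k ∈ range ((r + 2) * N + r + 1 + 1), (1 - q ^ (2 * (r + 3) * k + 1)) *
      vwpFactor q (r + 3) 1 k * vwpFactor q (r + 3) (z ^ (r + 2)) k *
      (vwpFactor q (r + 3) ((q ^ ((r + 3) * N + r + 2)) ^ 2) k * vwpFactor q (r + 3) z k) ^ e₁ *
      (vwpFactor q (r + 3) (q ^ ((r + 3) * N + r + 2)) k * vwpFactor q (r + 3) 1 k) ^ e₂ *
      q ^ ((r + 3) * (r + 1) * k) = 0 := by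
  set n := (r + 3) * N + r + 2 with hn
  set M := (r + 2) * N + r + 1 with hM
  have hMn : (r + 3) * M + 1 = n * (r + 2) := by rw [hM, hn]; ring
  have hq0 : q ≠ 0 := by
    rintro rfl
    rw [zero_pow (by omega), mul_zero] at hz
    exact zero_ne_one hz
  have hz0 : z ≠ 0 := left_ne_zero_of_mul_eq_one hz
  have hinj : ∀ a b, q ^ a = q ^ b → a = b := by
    have aux : ∀ a b, a ≤ b → q ^ a = q ^ b → a = b := by
      intro a b hab h
      obtain ⟨c, rfl⟩ := Nat.exists_eq_add_of_le hab
      by_contra hne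
      refine hq c (by omega) ?_
      rw [pow_add] at h
      exact (mul_left_cancel₀ (pow_ne_zero a hq0) (by rw [mul_one]; exact h)).symm
    intro a b h
    rcases le_total a b with hab | hab
    · exact aux a b hab h
    · exact (aux b a hab h.symm).symm
  obtain ⟨u, hu⟩ : ∃ u, q * u = 1 := ⟨q⁻¹, mul_inv_cancel₀ hq0⟩
  have h1 : ∀ j, (1 : K) ≠ q ^ ((r + 3) * (j + 1)) := fun j => (hq _ (by positivity)).symm
  have hzz : ∀ a, a ≠ 0 → ∀ j, z ^ a ≠ q ^ ((r + 3) * (j + 1)) := by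
    intro a ha j h
    refine hq (n * a + (r + 3) * (j + 1)) (by positivity) ?_
    rw [pow_add, pow_mul, ← h, ← mul_pow, mul_comm, hz, one_pow]
  have hy : ∀ j, q ^ n ≠ q ^ ((r + 3) * (j + 1)) := by
    intro j h
    have h2 : r + 3 ∣ (r + 3) * N + (r + 2) := ⟨j + 1, by rw [← hinj _ _ h, hn]; ring⟩
    have := Nat.le_of_dvd (by omega) ((Nat.dvd_add_right (Dvd.intro _ rfl)).1 h2)
    omega
  -- Here 2n ≡ -2 (mod d), which is nonzero because d ≥ 3.
  have hy2 : ∀ j, (q ^ n) ^ 2 ≠ q ^ ((r + 3) * (j + 1)) := by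
    intro j h
    rw [← pow_mul] at h
    have h2 : r + 3 ∣ (r + 3) * (2 * N + 1) + (r + 1) := ⟨j + 1, by rw [← hinj _ _ h, hn]; ring⟩
    have := Nat.le_of_dvd (by omega) ((Nat.dvd_add_right (Dvd.intro _ rfl)).1 h2)
    omega
  have hzi : (q ^ n)⁻¹ = z :=
    (eq_inv_of_mul_eq_one_left hz).symm
  have hnq : q ^ n * q = q ^ ((r + 3) * (N + 1)) :=
    (pow_succ q n).symm.trans (congrArg (q ^ ·) (by rw [hn]; ring))
  have hyz : (q ^ n) ^ 2 * z = q ^ n := by linear_combination q ^ n * hz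
  obtain ⟨P₁, hP₁, hE₁⟩ := vwpFactor_pair q u ((q ^ n) ^ 2) z (r + 3) N hu (by rw [hyz, hnq])
    (pow_ne_zero _ (pow_ne_zero _ hq0)) hz0 hy2 (by simpa using hzz 1 one_ne_zero)
  obtain ⟨P₂, hP₂, hE₂⟩ := vwpFactor_pair q u (q ^ n) 1 (r + 3) N hu (by rw [mul_one, hnq])
    (pow_ne_zero _ hq0) one_ne_zero hy h1
  rw [hyz, hzi] at hE₁
  rw [mul_one, hzi] at hE₂
  have hzw : q ^ ((r + 3) * M + 1) * z ^ (r + 2) = 1 := by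
    rw [hMn, pow_mul, ← mul_pow, mul_comm, hz, one_pow]
  obtain ⟨c, hc⟩ := lagrange_weight q u (z ^ (r + 2)) (r + 3) M hu hzw (fun j => (h1 j).symm)
    (hzz _ (by omega))
  have hdeg : (P₁ ^ e₁ * P₂ ^ e₂).natDegree < M := by
    refine (Polynomial.natDegree_mul_le.trans (add_le_add Polynomial.natDegree_pow_le
      Polynomial.natDegree_pow_le)).trans_lt ?_
    have : e₁ * P₁.natDegree + e₂ * P₂.natDegree ≤ e₁ * N + e₂ * N := by gcongr
    rw [← add_mul, he] at this
    omega
  have hinjv : Set.InjOn (fun k => u ^ ((r + 3) * k) + q ^ ((r + 3) * k + 1)) (range (M + 1)) := by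
    intro a _ b _ hab
    have p1 : q ^ ((r + 3) * a) * u ^ ((r + 3) * a) = 1 := by rw [← mul_pow, hu, one_pow]
    have p2 : q ^ ((r + 3) * b) * u ^ ((r + 3) * b) = 1 := by rw [← mul_pow, hu, one_pow]
    have h : (q ^ ((r + 3) * b) - q ^ ((r + 3) * a)) *
        (1 - q ^ ((r + 3) * a + (r + 3) * b + 1)) = 0 := by
      simp only at hab
      have e : q ^ ((r + 3) * a + (r + 3) * b + 1) = q ^ ((r + 3) * a) * q ^ ((r + 3) * b) * q := by
        rw [pow_succ, pow_add]
      rw [pow_succ, pow_succ] at hab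
      rw [e]
      linear_combination q ^ ((r + 3) * a) * q ^ ((r + 3) * b) * hab -
        q ^ ((r + 3) * b) * p1 + q ^ ((r + 3) * a) * p2
    rcases mul_eq_zero.1 h with h | h
    · have := hinj _ _ (sub_eq_zero.1 h)
      exact (Nat.eq_of_mul_eq_mul_left (by omega) this).symm
    · exact absurd (sub_eq_zero.1 h).symm (hq _ (by omega))
  rw [← sum_eval_mul_eq_zero hinjv hc hdeg]
  refine sum_congr rfl fun k _ => ?_
  -- The scalars from the pairs and q^(d(d-2)k) combine to the q^(-k) required by the interpolation
  -- weight.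
  have hs : ((z * q ^ ((r + 3) * N)) ^ k) ^ e₁ * ((z * q ^ ((r + 3) * N)) ^ k) ^ e₂ *
      q ^ ((r + 3) * (r + 1) * k) = u ^ k := by
    have e3 : (z * q ^ ((r + 3) * N)) ^ (r + 2) * q ^ ((r + 3) * (r + 1)) = u := by
      have : q ^ ((r + 3) * M + 1) = (q ^ ((r + 3) * N)) ^ (r + 2) * q ^ ((r + 3) * (r + 1)) * q := by
        rw [← pow_mul, ← pow_add, ← pow_succ, hM]; congr 1; ring
      rw [mul_pow]
      linear_combination u * hzw - z ^ (r + 2) * u * this -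
        z ^ (r + 2) * (q ^ ((r + 3) * N)) ^ (r + 2) * q ^ ((r + 3) * (r + 1)) * hu
    rw [← pow_add, he, ← pow_mul, mul_comm k, pow_mul, pow_mul q _ k, ← mul_pow, e3]
  rw [hE₁, hE₂, mul_pow, mul_pow, Polynomial.eval_mul, Polynomial.eval_pow, Polynomial.eval_pow, ← hs]
  ring

end KarlssonMinton

/-! ### Transport along ring homomorphisms. -/

section Map
variable {R S : Type*} [CommRing R] [CommRing S] (f : R →+* S)

/-- The unit hypothesis matters: `Ring.inverse` is 0 at a non-unit, whose image may be a unit. -/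
theorem map_ringInverse_of_isUnit {a : R} (ha : IsUnit a) :
    f (Ring.inverse a) = Ring.inverse (f a) := by
  rw [eq_comm, ← mul_one (Ring.inverse _), Ring.inverse_mul_eq_iff_eq_mul _ _ _ (ha.map f),
    ← map_mul, Ring.mul_inverse_cancel _ ha, map_one]

theorem map_vwpFactor (q x : R) (d k : ℕ) (h : ∀ j < k, IsUnit (x - q ^ (d * (j + 1)))) :
    f (vwpFactor q d x k) = vwpFactor (f q) d (f x) k := by
  rw [vwpFactor, vwpFactor, map_prod]
  refine prod_congr rfl fun j hj => ?_
  rw [map_mul, map_ringInverse_of_isUnit f (h j (mem_range.1 hj))]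
  simp

theorem map_vwpTerm (q : R) (d k : ℕ) (h : ∀ j < k, IsUnit (1 - q ^ (d * (j + 1)))) :
    f (vwpTerm q d k) = vwpTerm (f q) d k := by
  simp [vwpTerm, map_vwpFactor f q 1 d k h]

theorem map_logCubic (r i : R) : f (logCubic r i) = logCubic (f r) (f i) := by
  simp [logCubic, map_ofNat]

theorem map_vwpCubic (r q : R) (d k : ℕ) (h₁ : ∀ j < k, IsUnit (1 - q ^ (d * j + 1)))
    (h₂ : ∀ j < k, IsUnit (1 - q ^ (d * (j + 1)))) :
    f (vwpCubic r q d k) = vwpCubic (f r) (f q) d k := by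
  rw [vwpCubic, vwpCubic, map_sum]
  refine sum_congr rfl fun j hj => ?_
  rw [map_add, map_logCubic, map_logCubic, map_ringInverse_of_isUnit f (h₁ j (mem_range.1 hj)),
    map_ringInverse_of_isUnit f (h₂ j (mem_range.1 hj))]
  simp

end Map

section TruncExp
variable {B : Type*} [CommRing B] {r l : B}

theorem truncExp_pow (hr : 6 * r = 1) (hl : l ^ 4 = 0) (a : B) (k : ℕ) :
    truncExp r l a ^ k = truncExp r l (k * a) := by
  induction k with
  | zero => simp [truncExp_zero]
  | succ k ih => rw [pow_succ, ih, ← truncExp_add hr hl]; congr 1; push_cast; ring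

/-- The first argument e(1 - e/2 + e²/3) is log(1 + e) up to order three. -/
theorem truncExp_log (hr : 6 * r = 1) {e : B} (he : e ^ 4 = 0) :
    truncExp r (e * (1 - 3 * r * e + 2 * r * e ^ 2)) 1 = 1 + e := by
  unfold truncExp
  grind

theorem truncExp_mul_self (hl : l ^ 4 = 0) (a b : B) :
    truncExp r l (a * l + b * l ^ 2) = 1 + a * l ^ 2 + b * l ^ 3 := by
  unfold truncExp
  grind

end TruncExp

/-! ### Divisibility by the fourth power. -/

section Main

theorem coprime_of_eq {r N n : ℕ} (hn : n = (r + 3) * N + r + 2) : n.Coprime (r + 3) := by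
  have h1 : n.gcd (r + 3) ∣ n + 1 := (Nat.gcd_dvd_right _ _).trans ⟨N + 1, by rw [hn]; ring⟩
  exact Nat.dvd_one.1 ((Nat.dvd_add_right (Nat.gcd_dvd_left _ _)).1 h1)

/-- Expansion of the sum of Karlsson–Minton type to the third order. -/
theorem sum_vwp_expansion {B : Type*} [CommRing B] {s l q y z : B} (hs : 6 * s = 1) (hl : l ^ 4 = 0)
    (hy : y = truncExp s l 1) (hz : z = truncExp s l (-1)) (r M : ℕ)
    (h₁ : ∀ j < M, IsUnit (1 - q ^ ((r + 3) * j + 1)))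
    (h₂ : ∀ j < M, IsUnit (1 - q ^ ((r + 3) * (j + 1)))) :
    ∃ c : B, ∀ e₁ e₂ : ℕ, e₁ + e₂ = r + 2 →
      ∑ k ∈ range (M + 1), (1 - q ^ (2 * (r + 3) * k + 1)) *
        vwpFactor q (r + 3) 1 k * vwpFactor q (r + 3) (z ^ (r + 2)) k *
        (vwpFactor q (r + 3) (y ^ 2) k * vwpFactor q (r + 3) z k) ^ e₁ *
        (vwpFactor q (r + 3) y k * vwpFactor q (r + 3) 1 k) ^ e₂ * q ^ ((r + 3) * (r + 1) * k) =
      (∑ k ∈ range (M + 1), vwpTerm q (r + 3) k) + ((r + 2) ^ 2 + 5 * e₁ + e₂) * c +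
        (-(r + 2) ^ 3 + 7 * e₁ + e₂) *
          (l ^ 3 * ∑ k ∈ range (M + 1), vwpTerm q (r + 3) k * vwpCubic s q (r + 3) k) := by
  -- Outside the summation range the coefficients get the default 0, so that `choose` yields total
  -- functions.
  have hex : ∀ k, ∃ a b : B, k ∈ range (M + 1) → ∀ t : B,
      vwpFactor q (r + 3) (truncExp s l t) k = vwpFactor q (r + 3) 1 k *
        truncExp s l (a * t + b * t ^ 2 * l + vwpCubic s q (r + 3) k * t ^ 3 * l ^ 2) := by
    intro k
    by_cases hk : k ∈ range (M + 1)
    · have hk' := mem_range.1 hk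
      obtain ⟨a, b, h⟩ := exists_vwpFactor_truncExp hs hl q (r + 3) k
        (fun j hj => h₁ j (by omega)) (fun j hj => h₂ j (by omega))
      exact ⟨a, b, fun _ => h⟩
    · exact ⟨0, 0, fun h => absurd h hk⟩
  choose a b hab using hex
  refine ⟨∑ k ∈ range (M + 1), vwpTerm q (r + 3) k * (b k * l ^ 2), fun e₁ e₂ he => ?_⟩
  rw [mul_sum, mul_sum, mul_sum, ← sum_add_distrib, ← sum_add_distrib]
  refine sum_congr rfl fun k hk => ?_
  have h := hab k hk
  have hz' : z ^ (r + 2) = truncExp s l (-(r + 2)) := by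
    rw [hz, truncExp_pow hs hl]; congr 1; push_cast; ring
  have hy' : y ^ 2 = truncExp s l 2 := by
    rw [hy, truncExp_pow hs hl]; congr 1; push_cast; ring
  rw [hz', hy', h, h, hy, h, hz, h]
  have heB : (e₁ : B) + e₂ = r + 2 := by exact_mod_cast congrArg (Nat.cast : ℕ → B) he
  rw [vwpTerm]
  generalize vwpCubic s q (r + 3) k = g
  have hF : vwpFactor q (r + 3) 1 k ^ (2 * (r + 3)) =
      vwpFactor q (r + 3) 1 k * vwpFactor q (r + 3) 1 k *
        (vwpFactor q (r + 3) 1 k * vwpFactor q (r + 3) 1 k) ^ e₁ *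
        (vwpFactor q (r + 3) 1 k * vwpFactor q (r + 3) 1 k) ^ e₂ := by
    rw [mul_assoc _ (_ ^ e₁), ← pow_add, he]; ring
  -- The exponents are -(r+2), then 2 and -1 (e₁ times), and 1 (e₂ times). Their sum is 0, and their
  -- sums of squares and cubes are the two coefficients on the right.
  have hX : truncExp s l (a k * -(r + 2) + b k * (-(r + 2)) ^ 2 * l + g * (-(r + 2)) ^ 3 * l ^ 2) *
      (truncExp s l (a k * 2 + b k * 2 ^ 2 * l + g * 2 ^ 3 * l ^ 2) *
        truncExp s l (a k * -1 + b k * (-1) ^ 2 * l + g * (-1) ^ 3 * l ^ 2)) ^ e₁ *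
      truncExp s l (a k * 1 + b k * 1 ^ 2 * l + g * 1 ^ 3 * l ^ 2) ^ e₂ =
      1 + (b k * ((r + 2) ^ 2 + 5 * e₁ + e₂)) * l ^ 2 +
        (g * (-(r + 2) ^ 3 + 7 * e₁ + e₂)) * l ^ 3 := by
    rw [← truncExp_add hs hl, truncExp_pow hs hl, truncExp_pow hs hl, ← truncExp_add hs hl,
      ← truncExp_add hs hl, ← truncExp_mul_self (r := s) hl]
    congr 1
    linear_combination a k * heB
  rw [show r + 3 - 2 = r + 1 from rfl, hF]
  generalize vwpFactor q (r + 3) 1 k = F at *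
  generalize truncExp s l (a k * -(r + 2) + _ + _) = E₁ at *
  generalize truncExp s l (a k * 2 + _ + _) = E₂ at *
  generalize truncExp s l (a k * -1 + _ + _) = E₃ at *
  generalize truncExp s l (a k * 1 + _ + _) = E₄ at *
  linear_combination ((1 - q ^ (2 * (r + 3) * k + 1)) * F * F * (F * F) ^ e₁ * (F * F) ^ e₂ *
    q ^ ((r + 3) * (r + 1) * k)) * hX

end Main

theorem isUnit_pow_sub_pow {A : Type*} [CommRing A] {q : A} {n : ℕ} (hq : IsUnit q)
    (hu : ∀ j, ¬ n ∣ j → IsUnit (1 - q ^ j)) {a b : ℕ} (h : ¬ a ≡ b [MOD n]) :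
    IsUnit (q ^ a - q ^ b) := by
  rcases le_total a b with hab | hab
  · have : q ^ a - q ^ b = q ^ a * (1 - q ^ (b - a)) := by
      rw [mul_sub, ← pow_add, Nat.add_sub_cancel' hab, mul_one]
    rw [this]
    exact (hq.pow a).mul (hu _ fun hd => h ((Nat.modEq_iff_dvd' hab).2 hd))
  · have : q ^ a - q ^ b = -(q ^ b * (1 - q ^ (a - b))) := by
      rw [mul_sub, ← pow_add, Nat.add_sub_cancel' hab, mul_one, neg_sub]
    rw [this]
    exact ((hq.pow b).mul (hu _ fun hd => h ((Nat.modEq_iff_dvd' hab).2 hd).symm)).neg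

/-- Modulo p the terms are antisymmetric and g is symmetric, while 2 is invertible. -/
theorem dvd_sum_vwpTerm_mul {A : Type*} [CommRing A] {q p s : A} (hs : 6 * s = 1) {d M : ℕ}
    (hd : 2 ≤ d) (hp : p ∣ q ^ (d * M + 1) - 1)
    (hu : ∀ j < M, IsUnit (1 - q ^ (d * (j + 1)))) {g : ℕ → A}
    (hg : ∀ k k', k + k' = M → p ∣ g k' - g k) :
    p ∣ ∑ k ∈ range (M + 1), vwpTerm q d k * g k := by
  set f := Ideal.Quotient.mk (Ideal.span {p})
  have hf : ∀ x, p ∣ x ↔ f x = 0 := fun x => by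
    rw [Ideal.Quotient.eq_zero_iff_mem, Ideal.mem_span_singleton]
  rw [hf, map_sum]
  have h1 : f q ^ (d * M + 1) = 1 := by
    have := (hf _).1 hp
    rwa [map_sub, map_pow, map_one, sub_eq_zero] at this
  have h2 : ∀ j < M, IsUnit (1 - f q ^ (d * (j + 1))) := fun j hj => by
    simpa using (hu j hj).map f
  have h3 : 6 * f s = 1 := by rw [← map_ofNat f 6, ← map_mul, hs, map_one]
  rw [← sum_mul_eq_zero_of_antisymm h3 (vwpTerm_antisymm (f q) d M hd h1 h2)
    (g := fun k => f (g k)) fun k k' hk => ?_]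
  · refine sum_congr rfl fun k hk => ?_
    rw [map_mul, map_vwpTerm]
    exact fun j hj => hu j (by have := mem_range.1 hk; omega)
  · have := (hf _).1 (hg k k' hk)
    rwa [map_sub, sub_eq_zero] at this

theorem pow_four_dvd_sum_vwpTerm {A : Type*} [CommRing A] [IsDomain A] {q p s : A}
    (hs : 6 * s = 1) (hq : IsUnit q) (hq1 : ∀ j, j ≠ 0 → q ^ j ≠ 1) (r N n M : ℕ)
    (hn : n = (r + 3) * N + r + 2) (hM : M = (r + 2) * N + r + 1) (hp : p ∣ q ^ n - 1)
    (hu : ∀ j, ¬ n ∣ j → IsUnit (1 - q ^ j)) :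
    p ^ 4 ∣ ∑ k ∈ range (M + 1), vwpTerm q (r + 3) k := by
  have hMn : (r + 3) * M + 1 = n * (r + 2) := by rw [hM, hn]; ring
  have hMlt : M < n := by rw [hM, hn, show r + 3 = r + 2 + 1 from rfl, add_mul (r + 2)]; omega
  have hcop := coprime_of_eq hn
  have hn1 : ∀ j < M, ¬ n ∣ (r + 3) * (j + 1) := fun j hj hd => by
    have := Nat.le_of_dvd (by omega) (hcop.dvd_of_dvd_mul_left hd)
    omega
  -- Since (dj + 1) + d(M - j) = n(d - 1), this reduces to the reflected denominator exponent.
  have hn2 : ∀ j < M, ¬ n ∣ (r + 3) * j + 1 := fun j hj hd => by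
    obtain ⟨i, rfl⟩ := Nat.exists_eq_add_of_lt hj
    have h1 : n ∣ (r + 3) * (i + 1) := by
      refine (Nat.dvd_add_right hd).1 ⟨r + 2, ?_⟩
      rw [← hMn]; ring
    exact hn1 i (by omega) h1
  have u1 : ∀ j < M, IsUnit (1 - q ^ ((r + 3) * (j + 1))) := fun j hj => hu _ (hn1 j hj)
  have u2 : ∀ j < M, IsUnit (1 - q ^ ((r + 3) * j + 1)) := fun j hj => hu _ (hn2 j hj)
  obtain ⟨z, hz'⟩ := (hq.pow n).exists_right_inv
  have hz : z * q ^ n = 1 := by rw [mul_comm, hz']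
  have hzu : IsUnit z := IsUnit.of_mul_eq_one _ hz
  have uy : ∀ a, ∀ j < M, IsUnit ((q ^ n) ^ a - q ^ ((r + 3) * (j + 1))) := fun a j hj => by
    rw [← pow_mul]
    refine isUnit_pow_sub_pow hq hu fun h => hn1 j hj ?_
    exact (Nat.modEq_zero_iff_dvd.1 (h.symm.trans (Nat.modEq_zero_iff_dvd.2 (dvd_mul_right _ _))))
  have uz : ∀ a, ∀ j < M, IsUnit (z ^ a - q ^ ((r + 3) * (j + 1))) := fun a j hj => by
    have h : z ^ a - q ^ ((r + 3) * (j + 1)) = z ^ a * (1 - q ^ (n * a + (r + 3) * (j + 1))) := by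
      have : z ^ a * q ^ (n * a) = 1 := by rw [pow_mul, ← mul_pow, hz, one_pow]
      rw [pow_add]
      linear_combination q ^ ((r + 3) * (j + 1)) * this
    rw [h]
    exact (hzu.pow a).mul (hu _ fun hd => hn1 j hj ((Nat.dvd_add_right (dvd_mul_right _ _)).1 hd))
  -- the sums of Karlsson–Minton type, over any image of `A`
  have hmap : ∀ {S : Type _} [CommRing S] (f : A →+* S) (e₁ e₂ : ℕ),
      f (∑ k ∈ range (M + 1), (1 - q ^ (2 * (r + 3) * k + 1)) *
        vwpFactor q (r + 3) 1 k * vwpFactor q (r + 3) (z ^ (r + 2)) k *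
        (vwpFactor q (r + 3) ((q ^ n) ^ 2) k * vwpFactor q (r + 3) z k) ^ e₁ *
        (vwpFactor q (r + 3) (q ^ n) k * vwpFactor q (r + 3) 1 k) ^ e₂ *
        q ^ ((r + 3) * (r + 1) * k)) =
      ∑ k ∈ range (M + 1), (1 - f q ^ (2 * (r + 3) * k + 1)) *
        vwpFactor (f q) (r + 3) 1 k * vwpFactor (f q) (r + 3) (f z ^ (r + 2)) k *
        (vwpFactor (f q) (r + 3) ((f q ^ n) ^ 2) k * vwpFactor (f q) (r + 3) (f z) k) ^ e₁ *
        (vwpFactor (f q) (r + 3) (f q ^ n) k * vwpFactor (f q) (r + 3) 1 k) ^ e₂ *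
        f q ^ ((r + 3) * (r + 1) * k) := by
    intro S _ f e₁ e₂
    rw [map_sum]
    refine sum_congr rfl fun k hk => ?_
    have hk' := mem_range.1 hk
    have m1 := map_vwpFactor f q 1 (r + 3) k fun j hj => u1 j (by omega)
    have m2 := map_vwpFactor f q (z ^ (r + 2)) (r + 3) k fun j hj => uz _ j (by omega)
    have m3 := map_vwpFactor f q ((q ^ n) ^ 2) (r + 3) k fun j hj => uy _ j (by omega)
    have m4 := map_vwpFactor f q z (r + 3) k fun j hj => by simpa using uz 1 j (by omega)
    have m5 := map_vwpFactor f q (q ^ n) (r + 3) k fun j hj => by simpa using uy 1 j (by omega)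
    simp only [map_mul, map_pow, map_sub, map_one, m1, m2, m3, m4, m5]
  have hzero : ∀ e₁ e₂ : ℕ, e₁ + e₂ = r + 2 →
      ∑ k ∈ range (M + 1), (1 - q ^ (2 * (r + 3) * k + 1)) *
        vwpFactor q (r + 3) 1 k * vwpFactor q (r + 3) (z ^ (r + 2)) k *
        (vwpFactor q (r + 3) ((q ^ n) ^ 2) k * vwpFactor q (r + 3) z k) ^ e₁ *
        (vwpFactor q (r + 3) (q ^ n) k * vwpFactor q (r + 3) 1 k) ^ e₂ *
        q ^ ((r + 3) * (r + 1) * k) = 0 := by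
    intro e₁ e₂ he
    -- The vanishing is an identity over a field, so it is proved in the fraction field and pulled
    -- back.
    have hinj := IsFractionRing.injective A (FractionRing A)
    refine hinj ?_
    rw [hmap, map_zero, hM, hn]
    refine sum_karlssonMinton_eq_zero _ _ (fun j hj h => hq1 j hj (hinj ?_)) r N e₁ e₂ he ?_
    · rw [map_pow, h, map_one]
    · rw [← hn, ← map_pow, ← map_mul, hz, map_one]
  -- reduction modulo the fourth power
  set f := Ideal.Quotient.mk (Ideal.span {p ^ 4}) with hfdef
  have hf : ∀ x, p ^ 4 ∣ x ↔ f x = 0 := fun x => by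
    rw [hfdef, Ideal.Quotient.eq_zero_iff_mem, Ideal.mem_span_singleton]
  have hsB : 6 * f s = 1 := by rw [← map_ofNat f 6, ← map_mul, hs, map_one]
  set e := f (q ^ n - 1) with hedef
  have he4 : e ^ 4 = 0 := by
    rw [← map_pow, ← hf]
    exact pow_dvd_pow_of_dvd hp 4
  set l := e * (1 - 3 * f s * e + 2 * f s * e ^ 2) with hldef
  have hl4 : l ^ 4 = 0 := by rw [hldef, mul_pow, he4, zero_mul]
  have hyB : f q ^ n = truncExp (f s) l 1 := by
    rw [hldef, truncExp_log hsB he4, hedef, map_sub, map_pow, map_one]; ring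
  have hzB : f z = truncExp (f s) l (-1) := by
    have h1 := truncExp_mul_neg hsB hl4 1
    have h2 : f z * f q ^ n = 1 := by rw [← map_pow, ← map_mul, hz, map_one]
    rw [hyB] at h2
    linear_combination truncExp (f s) l (-1) * h2 - f z * h1
  have u1B : ∀ j < M, IsUnit (1 - f q ^ ((r + 3) * (j + 1))) := fun j hj => by
    simpa using (u1 j hj).map f
  have u2B : ∀ j < M, IsUnit (1 - f q ^ ((r + 3) * j + 1)) := fun j hj => by
    simpa using (u2 j hj).map f
  obtain ⟨c, hc⟩ := sum_vwp_expansion hsB hl4 hyB hzB r M u2B u1B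
  -- l^3 is a multiple of (q^n - 1)^3, hence of p^3; the sum gives one more factor p.
  have hcubic : l ^ 3 * ∑ k ∈ range (M + 1), vwpTerm (f q) (r + 3) k *
      vwpCubic (f s) (f q) (r + 3) k = 0 := by
    have hpM : p ∣ q ^ ((r + 3) * M + 1) - 1 := by
      rw [hMn, pow_mul]
      exact hp.trans (sub_one_dvd_pow_sub_one _ _)
    have h1 : p ∣ ∑ k ∈ range (M + 1), vwpTerm q (r + 3) k * vwpCubic s q (r + 3) k := by
      refine dvd_sum_vwpTerm_mul hs (by omega) hpM u1 fun k k' hk => ?_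
      set f₁ := Ideal.Quotient.mk (Ideal.span {p}) with hf1
      have hf₁ : ∀ x, p ∣ x ↔ f₁ x = 0 := fun x => by
        rw [hf1, Ideal.Quotient.eq_zero_iff_mem, Ideal.mem_span_singleton]
      rw [hf₁] at hpM ⊢
      rw [map_sub, map_vwpCubic f₁ s q (r + 3) k' (fun j hj => u2 j (by omega))
        (fun j hj => u1 j (by omega)), map_vwpCubic f₁ s q (r + 3) k (fun j hj => u2 j (by omega))
        (fun j hj => u1 j (by omega)), sub_eq_zero]
      refine vwpCubic_symm _ _ _ M ?_ (fun j hj => by simpa using (u1 j hj).map f₁) k k' hk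
      rwa [map_sub, map_pow, map_one, sub_eq_zero] at hpM
    have h2 : f ((q ^ n - 1) ^ 3 * ∑ k ∈ range (M + 1), vwpTerm q (r + 3) k *
        vwpCubic s q (r + 3) k) = 0 := by
      rw [← hf, pow_succ p 3]
      exact mul_dvd_mul (pow_dvd_pow_of_dvd hp 3) h1
    rw [map_mul, map_pow, map_sum] at h2
    rw [hldef, mul_pow, mul_right_comm]
    convert congrArg (· * (1 - 3 * f s * e + 2 * f s * e ^ 2) ^ 3) h2 using 1
    · congr 2
      refine sum_congr rfl fun k hk => ?_
      have hk' := mem_range.1 hk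
      rw [map_mul, map_vwpTerm f q _ k fun j hj => u1 j (by omega),
        map_vwpCubic f s q _ k (fun j hj => u2 j (by omega)) (fun j hj => u1 j (by omega))]
    · simp
  -- Moving one unit from e₂ to e₁ changes the quadratic coefficient by 5 - 1 = 4, which is
  -- invertible.
  have z1 := hc 0 (r + 2) (by omega)
  have z2 := hc 1 (r + 1) (by omega)
  rw [← hmap, hzero _ _ (by omega), map_zero, hcubic] at z1 z2
  push_cast at z1 z2
  rw [hf, map_sum, sum_congr rfl fun k hk => map_vwpTerm f q (r + 3) k fun j hj =>
    u1 j (by have := mem_range.1 hk; omega)]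
  have hc0 : c = 0 := by
    have h4 : 4 * c = 0 := by linear_combination z1 - z2
    linear_combination 9 * f s ^ 2 * h4 - c * (6 * f s + 1) * hsB
  rw [hc0] at z1
  linear_combination -z1

/-! ### Blocks of length m and the simple factors. -/

section Blocks
variable {A K : Type*} [CommRing A] [Field K] {ι : A →+* K} {q p s : A} {d m i₀ : ℕ}

/-- For b > i₀ the numerator contains the factor j = i₀, which is divisible by p. -/
theorem pow_dvd_vwpTerm (hp : p ∣ q ^ (d * i₀ + 1) - 1) {b : ℕ} (hb : i₀ < b) :
    p ^ (2 * d) ∣ vwpTerm q d b := by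
  have h : p ∣ vwpFactor q d 1 b := by
    refine Dvd.dvd.trans ?_ (dvd_prod_of_mem _ (mem_range.2 hb))
    rw [mul_one]
    exact Dvd.dvd.mul_right ((dvd_sub_comm).1 hp) _
  exact ((pow_dvd_pow_of_dvd h _).mul_left _).mul_right _

theorem not_dvd_of_dvd_mul_add_one (hi : m ∣ d * i₀ + 1) {j : ℕ} (hj : ¬ m ∣ j) :
    ¬ m ∣ d * j := fun h => by
  have hc : m.Coprime d := by
    have h1 : m.gcd d ∣ d * i₀ + 1 := (Nat.gcd_dvd_left _ _).trans hi
    exact Nat.dvd_one.1 ((Nat.dvd_add_right ((Nat.gcd_dvd_right m d).mul_right i₀)).1 h1)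
  exact hj (hc.dvd_of_dvd_mul_left h)

theorem dvd_sum_block (hs : 6 * s = 1) (hd : 2 ≤ d) (hm : i₀ < m) (hi : m ∣ d * i₀ + 1)
    (hp : p ∣ q ^ m - 1) (hu : ∀ j, ¬ m ∣ j → IsUnit (1 - q ^ j)) {b : ℕ}
    (hb : i₀ + 1 ≤ b) : p ∣ ∑ k ∈ range b, vwpTerm q d k := by
  have hp' : p ∣ q ^ (d * i₀ + 1) - 1 := by
    obtain ⟨c, hc⟩ := hi
    rw [hc, pow_mul]
    exact hp.trans (sub_one_dvd_pow_sub_one _ _)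
  obtain ⟨t, rfl⟩ := Nat.exists_eq_add_of_le hb
  rw [sum_range_add]
  refine dvd_add ?_ (dvd_sum fun j _ => ?_)
  · have := dvd_sum_vwpTerm_mul hs hd hp' (fun j hj => hu _ (not_dvd_of_dvd_mul_add_one hi
      fun h => by have := Nat.le_of_dvd (by omega) h; omega)) (g := fun _ => 1) (by simp)
    simpa using this
  · exact (dvd_pow_self p (by omega)).trans (pow_dvd_vwpTerm hp' (by omega))

/-- Denominators of later blocks need not be units in A, so the product is formed in K. Each block
has one denominator with exponent divisible by m, and its factor 1 - q^m cancels against the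
numerator at offset i₀. -/
theorem vwpFactor_one_block_mem (hq1 : ∀ j, j ≠ 0 → ι q ^ j ≠ 1) (hd : d ≠ 0) (hm : i₀ < m)
    (hi : m ∣ d * i₀ + 1) (hu : ∀ j, ¬ m ∣ j → IsUnit (1 - q ^ j))
    (hG : ∀ b, b ≠ 0 → IsUnit (∑ i ∈ range b, (q ^ m) ^ i)) (a : ℕ) :
    ∃ x : A, ι x = vwpFactor (ι q) d 1 (a * m) := by
  induction a with
  | zero => exact ⟨1, by simp [vwpFactor]⟩
  | succ a ih =>
    obtain ⟨x, hx⟩ := ih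
    have hG' : ∀ b, 1 - q ^ (m * b) = (1 - q ^ m) * ∑ i ∈ range b, (q ^ m) ^ i := fun b => by
      rw [mul_neg_geom_sum, pow_mul]
    have hnum : (1 - q ^ m) ∣ ∏ j ∈ range m, (1 - q ^ (d * (a * m + j) + 1)) := by
      refine Dvd.dvd.trans ?_ (dvd_prod_of_mem _ (mem_range.2 hm))
      obtain ⟨c, hc⟩ : m ∣ d * (a * m + i₀) + 1 := by
        rw [mul_add, add_assoc]
        exact dvd_add ((Dvd.intro_left a rfl).mul_left d) hi
      rw [hc, hG']
      exact dvd_mul_right _ _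
    obtain ⟨y, hy⟩ := hnum
    obtain ⟨g, hgu, hg⟩ : ∃ g, IsUnit g ∧
        ∏ j ∈ range m, (1 - q ^ (d * (a * m + j + 1))) = (1 - q ^ m) * g := by
      obtain ⟨m', rfl⟩ : ∃ m', m = m' + 1 := ⟨m - 1, by omega⟩
      rw [prod_range_succ, show d * (a * (m' + 1) + m' + 1) = (m' + 1) * (d * (a + 1)) by ring, hG',
        mul_left_comm]
      refine ⟨_, ?_, rfl⟩
      refine IsUnit.mul (IsUnit.prod_iff.2 fun j hj => hu _ ?_) (hG _ (by positivity))
      have hj := mem_range.1 hj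
      rw [show d * (a * (m' + 1) + j + 1) = (m' + 1) * (d * a) + d * (j + 1) by ring,
        Nat.dvd_add_right (dvd_mul_right _ _)]
      exact not_dvd_of_dvd_mul_add_one hi fun h => by
        have := Nat.le_of_dvd (by omega) h; omega
    refine ⟨x * (y * Ring.inverse g), ?_⟩
    have h1 : vwpFactor (ι q) d 1 ((a + 1) * m) = vwpFactor (ι q) d 1 (a * m) *
        (ι (∏ j ∈ range m, (1 - q ^ (d * (a * m + j) + 1))) *
          (ι (∏ j ∈ range m, (1 - q ^ (d * (a * m + j + 1)))))⁻¹) := by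
      rw [add_mul, one_mul, vwpFactor, prod_range_add, map_prod, map_prod, ← prod_inv_distrib,
        ← prod_mul_distrib]
      congr 1
      refine prod_congr rfl fun j _ => ?_
      simp
    have h2 : ι (1 - q ^ m) ≠ 0 := by
      rw [map_sub, map_one, map_pow]
      exact sub_ne_zero.2 (hq1 m (by omega)).symm
    rw [h1, ← hx, hy, hg, map_mul, map_mul, map_ringInverse_of_isUnit ι hgu, Ring.inverse_eq_inv,
      map_mul, map_mul]
    have h3 : ι g ≠ 0 := (hgu.map ι).ne_zero
    field_simp

/-- The constant x, the 2d-th power of the product over the first a blocks, does not depend on b;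
modulo p the rest has period m in the index. -/
theorem exists_vwpTerm_eq (hq1 : ∀ j, j ≠ 0 → ι q ^ j ≠ 1) (hd : d ≠ 0) (hm : i₀ < m)
    (hi : m ∣ d * i₀ + 1) (hp : p ∣ q ^ m - 1) (hu : ∀ j, ¬ m ∣ j → IsUnit (1 - q ^ j))
    (hG : ∀ b, b ≠ 0 → IsUnit (∑ i ∈ range b, (q ^ m) ^ i)) (a : ℕ) :
    ∃ x : A, ∀ b < m, ∃ y : A, ι (x * vwpTerm q d b + p * y) = vwpTerm (ι q) d (a * m + b) := by
  obtain ⟨x, hx⟩ := vwpFactor_one_block_mem hq1 hd hm hi hu hG a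
  refine ⟨x ^ (2 * d), fun b hb => ?_⟩
  have hun : ∀ c, ∀ j < b, IsUnit (1 - q ^ (d * (c * m + j + 1))) := fun c j hj => by
    refine hu _ ?_
    rw [show d * (c * m + j + 1) = m * (d * c) + d * (j + 1) by ring,
      Nat.dvd_add_right (dvd_mul_right _ _)]
    exact not_dvd_of_dvd_mul_add_one hi fun h => by
      have := Nat.le_of_dvd (by omega) h; omega
  set h : A := ∏ j ∈ range b, ((1 - q ^ (d * (a * m + j) + 1)) *
    Ring.inverse (1 - q ^ (d * (a * m + j + 1)))) with hh
  set t : A := (1 - q ^ (2 * d * (a * m + b) + 1)) * h ^ (2 * d) * q ^ (d * (d - 2) * (a * m + b))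
    with ht
  set f := Ideal.Quotient.mk (Ideal.span {p}) with hfdef
  have hf : ∀ x, p ∣ x ↔ f x = 0 := fun x => by
    rw [hfdef, Ideal.Quotient.eq_zero_iff_mem, Ideal.mem_span_singleton]
  have hqm : f q ^ m = 1 := by
    have := (hf _).1 hp
    rwa [map_sub, map_pow, map_one, sub_eq_zero] at this
  have hpow : ∀ c e, f q ^ (m * c + e) = f q ^ e := fun c e => by
    rw [pow_add, pow_mul, hqm, one_pow, one_mul]
  have hdvd : p ∣ t - vwpTerm q d b := by
    rw [hf, map_sub, sub_eq_zero, map_vwpTerm f q d b fun j hj => by simpa using hun 0 j hj]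
    have hfh : f h = vwpFactor (f q) d 1 b := by
      rw [hh, map_prod, vwpFactor]
      refine prod_congr rfl fun j hj => ?_
      rw [map_mul, map_ringInverse_of_isUnit f (hun a j (mem_range.1 hj)),
        show d * (a * m + j) + 1 = m * (d * a) + (d * j + 1) by ring,
        show d * (a * m + j + 1) = m * (d * a) + d * (j + 1) by ring]
      simp [hpow]
    rw [ht, map_mul, map_mul, map_pow, hfh, vwpTerm,
      show 2 * d * (a * m + b) + 1 = m * (2 * d * a) + (2 * d * b + 1) by ring,
      show d * (d - 2) * (a * m + b) = m * (d * (d - 2) * a) + d * (d - 2) * b by ring]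
    simp [hpow]
  obtain ⟨y, hy⟩ := hdvd
  refine ⟨x ^ (2 * d) * y, ?_⟩
  have hT : x ^ (2 * d) * vwpTerm q d b + p * (x ^ (2 * d) * y) = x ^ (2 * d) * t := by
    linear_combination (-x ^ (2 * d)) * hy
  have hιh : ι h = ∏ j ∈ range b, ((1 - ι q ^ (d * (a * m + j) + 1) * 1) *
      Ring.inverse (1 - ι q ^ (d * (a * m + j + 1)))) := by
    rw [hh, map_prod]
    refine prod_congr rfl fun j hj => ?_
    rw [map_mul, map_ringInverse_of_isUnit ι (hun a j (mem_range.1 hj))]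
    simp
  have hF : vwpFactor (ι q) d 1 (a * m + b) = ι x * ι h := by
    rw [hx, hιh, vwpFactor, prod_range_add]
    rfl
  rw [hT, vwpTerm, hF, ht]
  simp only [map_mul, map_pow, map_sub, map_one]
  ring

/-- The last block must be empty or contain all of 0, …, i₀, so that the antisymmetric cancellation
is complete. -/
theorem sum_vwpTerm_mem (hs : 6 * s = 1) (hq1 : ∀ j, j ≠ 0 → ι q ^ j ≠ 1) (hd : 2 ≤ d) (hm : i₀ < m)
    (hi : m ∣ d * i₀ + 1) (hp : p ∣ q ^ m - 1) (hu : ∀ j, ¬ m ∣ j → IsUnit (1 - q ^ j))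
    (hG : ∀ b, b ≠ 0 → IsUnit (∑ i ∈ range b, (q ^ m) ^ i)) (a b : ℕ)
    (hb : b = 0 ∨ i₀ + 1 ≤ b) (hbm : b ≤ m) :
    ∃ x : A, ι (p * x) = ∑ k ∈ range (a * m + b), vwpTerm (ι q) d k := by
  have hblock : ∀ a b, i₀ + 1 ≤ b → b ≤ m →
      ∃ x : A, ι (p * x) = ∑ k ∈ range b, vwpTerm (ι q) d (a * m + k) := by
    intro a b hb hbm
    obtain ⟨x, hx⟩ := exists_vwpTerm_eq hq1 (by omega) hm hi hp hu hG a
    have hx' : ∀ k, ∃ y, k < m → ι (x * vwpTerm q d k + p * y) = vwpTerm (ι q) d (a * m + k) := by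
      intro k
      by_cases hk : k < m
      · obtain ⟨y, hy⟩ := hx k hk
        exact ⟨y, fun _ => hy⟩
      · exact ⟨0, fun h => absurd h hk⟩
    choose y hy using hx'
    obtain ⟨z, hz⟩ := dvd_sum_block hs hd hm hi hp hu hb
    refine ⟨x * z + ∑ k ∈ range b, y k, ?_⟩
    rw [← sum_congr rfl fun k hk => hy k (by have := mem_range.1 hk; omega), ← map_sum,
      sum_add_distrib, ← mul_sum, ← mul_sum, hz]
    congr 1
    ring
  have hfull : ∀ a, ∃ x : A, ι (p * x) = ∑ k ∈ range (a * m), vwpTerm (ι q) d k := by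
    intro a
    induction a with
    | zero => exact ⟨0, by simp⟩
    | succ a ih =>
      obtain ⟨x, hx⟩ := ih
      obtain ⟨y, hy⟩ := hblock a m hm le_rfl
      exact ⟨x + y, by rw [mul_add, map_add, hx, hy, add_mul, one_mul, sum_range_add]⟩
  obtain ⟨x, hx⟩ := hfull a
  rcases hb with rfl | hb
  · exact ⟨x, by rw [hx, add_zero]⟩
  · obtain ⟨y, hy⟩ := hblock a b hb hbm
    exact ⟨x + y, by rw [mul_add, map_add, hx, hy, sum_range_add]⟩

end Blocks

theorem summand_mul_one_sub (d k : ℕ) :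
    summand d k * (1 - RatFunc.X) = vwpTerm (RatFunc.X : RatFunc ℚ) d k := by
  have h1 : (1 - RatFunc.X : RatFunc ℚ) * qInt RatFunc.X (2 * d * k + 1) =
      1 - RatFunc.X ^ (2 * d * k + 1) := mul_neg_geom_sum _ _
  have h2 : vwpFactor (RatFunc.X : RatFunc ℚ) d 1 k =
      qPoch RatFunc.X (RatFunc.X ^ d) k / qPoch (RatFunc.X ^ d) (RatFunc.X ^ d) k := by
    rw [vwpFactor_eq_div, qPoch, qPoch]
    congr 1
    · refine prod_congr rfl fun j _ => ?_
      rw [← pow_mul]; ring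
    · refine prod_congr rfl fun j _ => ?_
      rw [← pow_mul]; ring
  rw [vwpTerm, h2, ← h1, div_pow, summand]
  ring

theorem ratFunc_X_pow_ne_one (j : ℕ) (hj : j ≠ 0) : (RatFunc.X : RatFunc ℚ) ^ j ≠ 1 := by
  intro h
  have : (Polynomial.X : Polynomial ℚ) ^ j = 1 := by
    apply RatFunc.algebraMap_injective ℚ
    rw [map_pow, RatFunc.algebraMap_X, h, map_one]
  have h2 := congrArg Polynomial.natDegree this
  rw [Polynomial.natDegree_X_pow, Polynomial.natDegree_one] at h2
  exact hj h2

/-! ### The local ring at a cyclotomic polynomial. -/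

section Localization
variable (m : ℕ)

/-- The ideal generated by a cyclotomic polynomial over `ℚ`. -/
noncomputable def cyclotomicIdeal : Ideal (Polynomial ℚ) := Ideal.span {Polynomial.cyclotomic m ℚ}

instance isPrime_cyclotomicIdeal [NeZero m] : (cyclotomicIdeal m).IsPrime :=
  (Ideal.span_singleton_prime (Polynomial.cyclotomic_ne_zero m ℚ)).2
    (Polynomial.cyclotomic.irreducible_rat (NeZero.pos m)).prime

variable [NeZero m]

/-- The local ring of the rational functions in `q` at the `m`-th cyclotomic polynomial. -/
abbrev CyclotomicLocal : Type := Localization.AtPrime (cyclotomicIdeal m)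

theorem isUnit_algebraMap_of_aeval_ne_zero {ζ : ℂ} (hζ : IsPrimitiveRoot ζ m) {P : Polynomial ℚ}
    (hP : Polynomial.aeval ζ P ≠ 0) : IsUnit (algebraMap (Polynomial ℚ) (CyclotomicLocal m) P) := by
  rw [IsLocalization.AtPrime.isUnit_to_map_iff _ (cyclotomicIdeal m)]
  intro h
  obtain ⟨Q, rfl⟩ := Ideal.mem_span_singleton.1 h
  refine hP ?_
  have h0 : Polynomial.aeval ζ (Polynomial.cyclotomic m ℚ) = 0 := by
    rw [Polynomial.aeval_def, Polynomial.eval₂_eq_eval_map, Polynomial.map_cyclotomic]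
    exact hζ.isRoot_cyclotomic (NeZero.pos m)
  rw [map_mul, h0, zero_mul]

/-- The embedding of the local ring into the rational functions. -/
noncomputable def toRatFunc : CyclotomicLocal m →+* RatFunc ℚ :=
  IsLocalization.lift (M := (cyclotomicIdeal m).primeCompl) (g := algebraMap (Polynomial ℚ) (RatFunc ℚ))
    fun y => by
      refine isUnit_iff_ne_zero.2 fun h => y.2 ?_
      rw [(map_eq_zero_iff _ (RatFunc.algebraMap_injective ℚ)).1 h]
      exact Ideal.zero_mem _

theorem toRatFunc_algebraMap (P : Polynomial ℚ) :
    toRatFunc m (algebraMap _ _ P) = algebraMap (Polynomial ℚ) (RatFunc ℚ) P :=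
  IsLocalization.lift_eq _ _

/-- The denominator of a is coprime to Φ_m, so it cannot absorb any factor of Φ_m^j. -/
theorem pow_dvd_num_of_eq_toRatFunc (j : ℕ) (a : CyclotomicLocal m) {f : RatFunc ℚ}
    (hf : toRatFunc m (algebraMap _ (CyclotomicLocal m) (Polynomial.cyclotomic m ℚ) ^ j * a) = f) :
    Polynomial.cyclotomic m ℚ ^ j ∣ f.num := by
  obtain ⟨⟨P, D⟩, hPD⟩ := IsLocalization.surj (cyclotomicIdeal m).primeCompl a
  have hD : ¬ Polynomial.cyclotomic m ℚ ∣ D := fun h => D.2 (Ideal.mem_span_singleton.2 h)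
  have h1 : f * algebraMap _ _ (D : Polynomial ℚ) =
      algebraMap (Polynomial ℚ) (RatFunc ℚ) (Polynomial.cyclotomic m ℚ ^ j * P) := by
    rw [← hf, ← toRatFunc_algebraMap m, ← map_mul, mul_assoc, hPD, ← toRatFunc_algebraMap m]
    simp only [map_mul, map_pow]
  have h2 : f.num * D = Polynomial.cyclotomic m ℚ ^ j * P * f.denom := by
    apply RatFunc.algebraMap_injective ℚ
    have h3 : algebraMap (Polynomial ℚ) (RatFunc ℚ) f.denom ≠ 0 :=
      (map_ne_zero_iff _ (RatFunc.algebraMap_injective ℚ)).2 f.denom_ne_zero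
    rw [map_mul _ _ f.denom, ← h1, map_mul]
    nth_rewrite 2 [← RatFunc.num_div_denom f]
    field_simp
  have hcop : IsCoprime (Polynomial.cyclotomic m ℚ ^ j) (D : Polynomial ℚ) :=
    ((Polynomial.cyclotomic.irreducible_rat (NeZero.pos m)).coprime_iff_not_dvd.2 hD).pow_left
  exact hcop.dvd_of_dvd_mul_right ⟨P * f.denom, by rw [h2, mul_assoc]⟩

variable {m}

theorem isUnit_one_sub_X_pow {j : ℕ} (hj : ¬ m ∣ j) :
    IsUnit (1 - algebraMap (Polynomial ℚ) (CyclotomicLocal m) Polynomial.X ^ j) := by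
  have hζ := Complex.isPrimitiveRoot_exp m (NeZero.ne m)
  rw [← map_pow, ← map_one (algebraMap (Polynomial ℚ) (CyclotomicLocal m)), ← map_sub]
  refine isUnit_algebraMap_of_aeval_ne_zero m hζ ?_
  rw [map_sub, map_one, map_pow, Polynomial.aeval_X]
  exact sub_ne_zero.2 fun h => hj ((hζ.pow_eq_one_iff_dvd j).1 h.symm)

/-- At a primitive m-th root of unity the sum equals b, nonzero in characteristic 0. -/
theorem isUnit_sum_X_pow_pow {b : ℕ} (hb : b ≠ 0) :
    IsUnit (∑ i ∈ range b,
      (algebraMap (Polynomial ℚ) (CyclotomicLocal m) Polynomial.X ^ m) ^ i) := by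
  have hζ := Complex.isPrimitiveRoot_exp m (NeZero.ne m)
  simp_rw [← map_pow]
  rw [← map_sum]
  refine isUnit_algebraMap_of_aeval_ne_zero m hζ ?_
  simp [hζ.pow_eq_one, hb]

theorem isUnit_algebraMap_X :
    IsUnit (algebraMap (Polynomial ℚ) (CyclotomicLocal m) Polynomial.X) := by
  have hζ := Complex.isPrimitiveRoot_exp m (NeZero.ne m)
  refine isUnit_algebraMap_of_aeval_ne_zero m hζ ?_
  rw [Polynomial.aeval_X]
  exact hζ.ne_zero (NeZero.ne m)

variable (m)

theorem cyclotomic_dvd_X_pow_sub_one :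
    algebraMap (Polynomial ℚ) (CyclotomicLocal m) (Polynomial.cyclotomic m ℚ) ∣
      algebraMap (Polynomial ℚ) (CyclotomicLocal m) Polynomial.X ^ m - 1 := by
  have := map_dvd (algebraMap (Polynomial ℚ) (CyclotomicLocal m))
    (Polynomial.cyclotomic.dvd_X_pow_sub_one m ℚ)
  simpa using this

theorem six_mul_inv :
    6 * algebraMap (Polynomial ℚ) (CyclotomicLocal m) (Polynomial.C (1 / 6)) = 1 := by
  rw [← map_ofNat (algebraMap (Polynomial ℚ) (CyclotomicLocal m)) 6, ← map_mul,
    ← map_ofNat Polynomial.C 6, ← Polynomial.C_mul]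
  norm_num

theorem toRatFunc_X : toRatFunc m (algebraMap (Polynomial ℚ) _ Polynomial.X) = RatFunc.X := by
  rw [toRatFunc_algebraMap, RatFunc.algebraMap_X]

variable {m}

/-- Divisibility of the numerator of the sum, from an evaluation in the local ring. -/
theorem pow_dvd_num_sum_summand (hm : m ≠ 1) {d L j : ℕ} (a : CyclotomicLocal m)
    (ha : toRatFunc m (algebraMap _ (CyclotomicLocal m) (Polynomial.cyclotomic m ℚ) ^ j * a) =
      ∑ k ∈ range L, vwpTerm (RatFunc.X : RatFunc ℚ) d k) :
    Polynomial.cyclotomic m ℚ ^ j ∣ (∑ k ∈ range L, summand d k).num := by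
  -- Because m ≠ 1, the extra factor 1 - q can be divided out in the local ring.
  have hu := isUnit_one_sub_X_pow (m := m) (j := 1) (by rwa [Nat.dvd_one])
  rw [pow_one] at hu
  refine pow_dvd_num_of_eq_toRatFunc m j (a * Ring.inverse (1 -
    algebraMap (Polynomial ℚ) (CyclotomicLocal m) Polynomial.X)) ?_
  rw [← mul_assoc, map_mul, ha, map_ringInverse_of_isUnit _ hu, Ring.inverse_eq_inv, map_sub,
    map_one, toRatFunc_X, ← sum_congr rfl fun k _ => summand_mul_one_sub d k, ← sum_mul]
  have h0 : (1 - RatFunc.X : RatFunc ℚ) ≠ 0 := by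
    have := ratFunc_X_pow_ne_one 1 one_ne_zero
    rw [pow_one] at this
    exact sub_ne_zero.2 this.symm
  rw [mul_assoc, mul_inv_cancel₀ h0, mul_one]

end Localization

/-! ### Assembling the cyclotomic factors. -/

theorem cyclotomic_dvd_num_sum_summand {d m i₀ : ℕ} (hd : 2 ≤ d) (hm1 : m ≠ 1) (hm : i₀ < m)
    (hi : m ∣ d * i₀ + 1) (a b : ℕ) (hb : b = 0 ∨ i₀ + 1 ≤ b) (hbm : b ≤ m) :
    Polynomial.cyclotomic m ℚ ∣ (∑ k ∈ range (a * m + b), summand d k).num := by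
  have : NeZero m := ⟨by omega⟩
  obtain ⟨x, hx⟩ := sum_vwpTerm_mem (ι := toRatFunc m) (six_mul_inv m)
    (by rw [toRatFunc_X]; exact ratFunc_X_pow_ne_one) hd hm hi (cyclotomic_dvd_X_pow_sub_one m)
    (fun j hj => isUnit_one_sub_X_pow hj) (fun b hb => isUnit_sum_X_pow_pow hb) a b hb hbm
  rw [toRatFunc_X] at hx
  have := pow_dvd_num_sum_summand (j := 1) hm1 x (by rw [pow_one, hx])
  rwa [pow_one] at this

theorem cyclotomic_pow_four_dvd_num_sum_summand {r N n M L : ℕ} (hn : n = (r + 3) * N + r + 2)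
    (hM : M = (r + 2) * N + r + 1) (hL : M + 1 ≤ L) (hLn : L ≤ n) :
    Polynomial.cyclotomic n ℚ ^ 4 ∣ (∑ k ∈ range L, summand (r + 3) k).num := by
  have : NeZero n := ⟨by omega⟩
  have hMn : (r + 3) * M + 1 = n * (r + 2) := by rw [hM, hn]; ring
  have hq1 : ∀ j, j ≠ 0 → algebraMap (Polynomial ℚ) (CyclotomicLocal n) Polynomial.X ^ j ≠ 1 := by
    intro j hj h
    refine ratFunc_X_pow_ne_one j hj ?_
    rw [← toRatFunc_X n, ← map_pow, h, map_one]
  have hp := cyclotomic_dvd_X_pow_sub_one n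
  have h1 := pow_four_dvd_sum_vwpTerm (six_mul_inv n) isUnit_algebraMap_X hq1 r N n M hn hM
    hp fun j hj => isUnit_one_sub_X_pow hj
  have hp' : algebraMap (Polynomial ℚ) (CyclotomicLocal n) (Polynomial.cyclotomic n ℚ) ∣
      algebraMap (Polynomial ℚ) (CyclotomicLocal n) Polynomial.X ^ ((r + 3) * M + 1) - 1 := by
    rw [hMn, pow_mul]
    exact hp.trans (sub_one_dvd_pow_sub_one _ _)
  have h2 : algebraMap (Polynomial ℚ) (CyclotomicLocal n) (Polynomial.cyclotomic n ℚ) ^ 4 ∣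
      ∑ k ∈ range L, vwpTerm (algebraMap (Polynomial ℚ) (CyclotomicLocal n) Polynomial.X) (r + 3) k := by
    obtain ⟨t, rfl⟩ := Nat.exists_eq_add_of_le hL
    rw [sum_range_add]
    -- Terms beyond M are divisible by the power 2d ≥ 4.
    exact dvd_add h1 (dvd_sum fun j _ => (pow_dvd_pow _ (by omega)).trans
      (pow_dvd_vwpTerm hp' (by omega)))
  obtain ⟨a, ha⟩ := h2
  refine pow_dvd_num_sum_summand (by omega) a ?_
  rw [← ha, map_sum]
  refine sum_congr rfl fun k hk => ?_
  have hk := mem_range.1 hk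
  rw [map_vwpTerm, toRatFunc_X]
  intro j hj
  refine isUnit_one_sub_X_pow (not_dvd_of_dvd_mul_add_one (Dvd.intro _ hMn.symm) fun h => ?_)
  have := Nat.le_of_dvd (by omega) h
  omega

theorem modulus_dvd {n : ℕ} (hn : 1 < n) {P : Polynomial ℚ}
    (h1 : ∀ m, m ∣ n → m ≠ 1 → Polynomial.cyclotomic m ℚ ∣ P)
    (h2 : Polynomial.cyclotomic n ℚ ^ 4 ∣ P) : modulus n ∣ P := by
  have hmem : n ∈ n.divisors.erase 1 :=
    mem_erase.2 ⟨by omega, Nat.mem_divisors_self n (by omega)⟩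
  have h3 : modulus n = ∏ m ∈ n.divisors.erase 1,
      Polynomial.cyclotomic m ℚ ^ (if m = n then 4 else 1) := by
    rw [modulus, qInt, ← Polynomial.prod_cyclotomic_eq_geom_sum (by omega),
      ← mul_prod_erase _ _ hmem, ← mul_prod_erase _ _ hmem, if_pos rfl, mul_right_comm, ← pow_succ']
    congr 1
    refine prod_congr rfl fun m hm => ?_
    rw [if_neg (ne_of_mem_erase hm), pow_one]
  rw [h3]
  refine prod_dvd_of_coprime (fun a _ b _ hab => ?_) fun m hm => ?_
  · exact (Polynomial.cyclotomic.isCoprime_rat hab).pow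
  · split_ifs with hmn
    · rw [hmn]; exact h2
    · rw [pow_one]
      exact h1 m (Nat.dvd_of_mem_divisors (mem_of_mem_erase hm)) (ne_of_mem_erase hm)

end QCong

theorem mainTheorem3 (d n : ℕ) (hd : 3 ≤ d) (hn : 0 < n) (hmod : (n : ℤ) ≡ -1 [ZMOD (d : ℤ)])
    (M : ℕ) (hM : M = ((d - 1) * n - 1) / d ∨ M = n - 1) :
    QCong.RatModEq (QCong.modulus n)
      (∑ k ∈ Finset.range (M + 1), QCong.summand d k) 0 := by
  obtain ⟨r, rfl⟩ : ∃ r, d = r + 3 := ⟨d - 3, by omega⟩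
  obtain ⟨N, hN⟩ : ∃ N, n = (r + 3) * N + r + 2 := by
    have h : ((r + 3 : ℕ) : ℤ) ∣ ((n + 1 : ℕ) : ℤ) := by
      have := hmod.symm.dvd
      push_cast at this ⊢
      simpa using this
    obtain ⟨c, hc⟩ := Int.natCast_dvd_natCast.1 h
    obtain ⟨N, rfl⟩ : ∃ N, c = N + 1 := ⟨c - 1, by
      have : c ≠ 0 := by rintro rfl; omega
      omega⟩
    exact ⟨N, by rw [mul_add] at hc; omega⟩
  set M₀ := (r + 2) * N + r + 1 with hM₀
  have hMn : (r + 3) * M₀ + 1 = n * (r + 2) := by rw [hM₀, hN]; ring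
  have hM' : M = M₀ ∨ M = n - 1 := by
    refine hM.imp_left fun h => ?_
    rw [h, show r + 3 - 1 = r + 2 from rfl, mul_comm (r + 2) n, ← hMn, Nat.add_sub_cancel,
      Nat.mul_div_cancel_left _ (by omega)]
  have hMlt : M₀ < n := by rw [hM₀, hN, show r + 3 = r + 2 + 1 from rfl, add_mul (r + 2)]; omega
  rw [QCong.RatModEq, sub_zero]
  refine QCong.modulus_dvd (by omega) (fun m hm hm1 => ?_)
    (QCong.cyclotomic_pow_four_dvd_num_sum_summand hN hM₀ (by omega) (by omega))
  have hm0 : 0 < m := Nat.pos_of_dvd_of_pos hm hn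
  have hlt := Nat.mod_lt M₀ hm0
  -- i₀ = M₀ mod m serves for every m, since m ∣ n ∣ d M₀ + 1.
  have hi : m ∣ (r + 3) * (M₀ % m) + 1 := by
    have h1 : m ∣ (r + 3) * M₀ + 1 := hMn ▸ hm.mul_right _
    rw [← Nat.mod_add_div M₀ m] at h1
    rw [show (r + 3) * (M₀ % m + m * (M₀ / m)) + 1 =
      m * ((r + 3) * (M₀ / m)) + ((r + 3) * (M₀ % m) + 1) by ring] at h1
    exact (Nat.dvd_add_right (dvd_mul_right _ _)).1 h1
  -- For M₀ the last block stops exactly at i₀; for n - 1 there are n/m full blocks and nothing left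
  -- over.
  rcases hM' with rfl | rfl
  · have := QCong.cyclotomic_dvd_num_sum_summand (by omega) hm1 hlt hi (M₀ / m) (M₀ % m + 1)
      (Or.inr le_rfl) hlt
    rwa [← add_assoc, mul_comm (M₀ / m), Nat.div_add_mod] at this
  · have := QCong.cyclotomic_dvd_num_sum_summand (by omega) hm1 hlt hi (n / m) 0
      (Or.inl rfl) (Nat.zero_le _)
    rwa [add_zero, Nat.div_mul_cancel hm, ← Nat.sub_add_cancel hn] at this
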